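/- Work in Kohlenbach's higher-order arithmetic: $\mathsf{RCA}_0^{\omega}$ is classical arithmetic in all finite types with the combinators, the recursor with values in $\mathbb N$, extensionality, quantifier-free induction and $\mathsf{QF\text{-}AC}^{1,0}$; $\mathsf{ACA}_0^{\omega}$ is $\mathsf{RCA}_0^{\omega}+(\exists^2)$, where $(\exists^2)$ states that there is $E:\mathbb N^{\mathbb N}\to\{0,1\}$ with $(\exists n)(f(n)=0)\leftrightarrow E(f)=0$ for all $f\in\mathbb N^{\mathbb N}$; and $\Sigma\text{-}\mathsf{IND}$ is induction for the formulas $\varphi(n)\equiv(\exists f\in\mathbb N^{\mathbb N})(Y(f,n)=0)$, for any $Y:\mathbb N^{\mathbb N}\times\mathbb N\to\mathbb N$. Reals are coded by sequences $(q_n)$ of rationals with $|q_n-q_{n+m}|\le 2^{-n}$, and sets are given by characteristic functions. A metric space $(M,d)$ with $M=\mathbb N^{\mathbb N}$ consists of an equivalence relation $=_M$ on $\mathbb N^{\mathbb N}$ and $d:M^2\to\mathbb R$ such that $d(x,y)=0\leftrightarrow x=_My$, $0\le d(x,y)=d(y,x)$ and $d(x,y)\le d(x,z)+d(z,y)$;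 functions on $M$ and subsets of $M$ respect $=_M$. $(M,d)$ is *sequentially compact* if every sequence has a convergent subsequence; *limit point compact* if every infinite subset of $M$ has a limit point, where $X\subset M$ is finite if for some $N$, among any $N+1$ pairwise different points $x_0,\dots,x_N$ of $M$ one is not in $X$; *countably compact* if for every sequence of open sets $(O_n)_{n\in\mathbb N}$ covering $M$ there is $m$ such that $O_0,\dots,O_m$ cover $M$; and *open-cover compact* if for every $\Psi:M\to\mathbb R^+$ there are $x_0,\dots,x_k\in M$ such that the open balls $B(x_i,\Psi(x_i))$, $i\le k$, cover $M$. **Theorem.** Let "compact" stand for any one of "sequentially compact", "limit point compact", "countably compact", "open-cover compact". Over $\mathsf{ACA}_0^{\omega}+\Sigma\text{-}\mathsf{IND}$ (i.e. in every model of this theory; equivalently, by completeness, provably in it) the following are equivalent. 1. (Supremum principle.) For every compact $(M,d)$ with $M=\mathbb N^{\mathbb N}$, every continuous $f:M\to[0,1]$ and every $x\in M$, there is a sequence of reals $(y_n)_{n\in\mathbb N}$ with $y_n=\sup_{z\in\overline B(x,2^{-n})}f(z)$ for all $n\in\mathbb N$, where $\overline B(x,2^{-n})=\{z\in M: d(x,z)\le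 2^{-n}\}$. 2. Item 1 restricted to Lipschitz continuous $f$. 3. (Sequential supremum principle.) For every compact $(M,d)$ with $M=\mathbb N^{\mathbb N}$ and every sequence $(f_n)_{n\in\mathbb N}$ of continuous functions $M\to[0,1]$, there is a sequence of reals $(y_n)_{n\in\mathbb N}$ with $y_n=\sup_{x\in M}f_n(x)$ for all $n\in\mathbb N$. 4. (Feferman's projection principle $\mathsf{BOOT}$.) For every $Y:\mathbb N^{\mathbb N}\times\mathbb N\to\mathbb N$ there is $X\subset\mathbb N$ such that for all $n\in\mathbb N$: $n\in X\leftrightarrow(\exists f\in\mathbb N^{\mathbb N})(Y(f,n)=0)$. -/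

import Mathlib

/-!
  Higher-order arithmetic in Kohlenbach's base theory, treated through its models.

  A structure for the language of arithmetic in all finite types consists of one carrier for each
  finite type, an application operation, and interpretations of the constants.  A theory in this
  language proves a sentence exactly when the sentence holds in all models of the theory (completeness
  of many-sorted classical first-order logic), and this is how "over the base theory" is read.  All
  carriers are arbitrary: the numbers of a model may be nonstandard, and its higher types need not
  contain all functions.  In the definitions of the principles, every quantifier over numbers,
  functions, functionals, reals, sets, sequences and finite sequences ranges over a carrier of
  the model.
-/

universe u

namespace HigherOrderRM

/-- Finite types. -/
inductive Ty : Type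
  | nat : Ty
  | arr : Ty → Ty → Ty

infixr:60 " ⇒ " => Ty.arr

/-- The type of numbers. -/
abbrev T0 : Ty := Ty.nat

/-- The type of number-theoretic functions; it is also the type of (codes of) real numbers. -/
abbrev T1 : Ty := T0 ⇒ T0

/-- A structure for the language of arithmetic in all finite types: carriers, application, zero,
successor, the combinators `K` and `S`, and the recursor `R` with values of type `T0`. -/
structure TypeStructure where
  El : Ty → Type u
  app : ∀ {σ τ : Ty}, El (σ ⇒ τ) → El σ → El τ
  zero : El T0
  succ : El T1
  K : ∀ σ τ : Ty, El (σ ⇒ τ ⇒ σ)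
  S : ∀ ρ σ τ : Ty, El ((ρ ⇒ σ ⇒ τ) ⇒ (ρ ⇒ σ) ⇒ ρ ⇒ τ)
  R : El (T0 ⇒ (T0 ⇒ T0 ⇒ T0) ⇒ T0 ⇒ T0)

instance (M : TypeStructure.{u}) (σ τ : Ty) :
    CoeFun (M.El (σ ⇒ τ)) (fun _ => M.El σ → M.El τ) := ⟨M.app⟩

/-- The predicates given by quantifier-free formulas: Boolean combinations of equations between
members of a given class `T` of terms, that is, of `N`-valued functions. -/
inductive QuantifierFree {X N : Type u} (T : Set (X → N)) : (X → Prop) → Prop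
  | eq (s t : X → N) : s ∈ T → t ∈ T → QuantifierFree T (fun x => s x = t x)
  | neg (A : X → Prop) : QuantifierFree T A → QuantifierFree T (fun x => ¬ A x)
  | conj (A B : X → Prop) : QuantifierFree T A → QuantifierFree T B →
      QuantifierFree T (fun x => A x ∧ B x)
  | disj (A B : X → Prop) : QuantifierFree T A → QuantifierFree T B →
      QuantifierFree T (fun x => A x ∨ B x)
  | impl (A B : X → Prop) : QuantifierFree T A → QuantifierFree T B →
      QuantifierFree T (fun x => A x → B x)

namespace TypeStructure

variable (M : TypeStructure.{u})

/-- Quantifier-free predicates of one number, with parameters from `M`.  By the combinators, every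
term of type `T0` with a number variable `n` has the form `f n`, with `f` not containing `n`. -/
def QFNumber (A : M.El T0 → Prop) : Prop :=
  QuantifierFree {s | ∃ f : M.El T1, s = fun n => f n} A

/-- Quantifier-free predicates of a function and a number, with parameters from `M`. -/
def QFFunctionNumber (A : M.El T1 × M.El T0 → Prop) : Prop :=
  QuantifierFree {s | ∃ Y : M.El (T1 ⇒ T0 ⇒ T0), s = fun p => Y p.1 p.2} A

/-- The axioms of `RCA₀^ω`.  Equality of numbers is the only primitive equality of the language, and
equality at type `σ ⇒ τ` abbreviates pointwise equality; the axioms of extensionality make it a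
congruence.  Passing to the quotient, one takes it to be true equality, which is `ext`. -/
structure ModelsRCA : Prop where
  K_eq : ∀ {σ τ : Ty} (x : M.El σ) (y : M.El τ), M.K σ τ x y = x
  S_eq : ∀ {ρ σ τ : Ty} (x : M.El (ρ ⇒ σ ⇒ τ)) (y : M.El (ρ ⇒ σ)) (z : M.El ρ),
    M.S ρ σ τ x y z = x z (y z)
  R_zero : ∀ (y : M.El T0) (z : M.El (T0 ⇒ T0 ⇒ T0)), M.R y z M.zero = y
  R_succ : ∀ (y : M.El T0) (z : M.El (T0 ⇒ T0 ⇒ T0)) (n : M.El T0),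
    M.R y z (M.succ n) = z (M.R y z n) n
  succ_ne_zero : ∀ n : M.El T0, M.succ n ≠ M.zero
  succ_inj : ∀ m n : M.El T0, M.succ m = M.succ n → m = n
  ext : ∀ {σ τ : Ty} (f g : M.El (σ ⇒ τ)), (∀ x : M.El σ, f x = g x) → f = g
  /-- Induction for quantifier-free formulas. -/
  qf_ind : ∀ A : M.El T0 → Prop, M.QFNumber A →
    A M.zero → (∀ n, A n → A (M.succ n)) → ∀ n, A n
  /-- The axiom of choice for quantifier-free formulas, from functions to numbers. -/
  qf_ac : ∀ A : M.El T1 × M.El T0 → Prop, M.QFFunctionNumber A →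
    (∀ f, ∃ n, A (f, n)) → ∃ Φ : M.El (T1 ⇒ T0), ∀ f, A (f, Φ f)

/-- The number one. -/
def one : M.El T0 := M.succ M.zero

/-- The existence of Kleene's quantifier `∃²`. -/
def KleeneE2 : Prop :=
  ∃ E : M.El (T1 ⇒ T0), (∀ f, E f = M.zero ∨ E f = M.one) ∧
    ∀ f : M.El T1, (∃ n : M.El T0, f n = M.zero) ↔ E f = M.zero

/-- The axioms of `ACA₀^ω`. -/
def ModelsACA : Prop := M.ModelsRCA ∧ M.KleeneE2

/-- Induction for formulas of the form `(∃ f : ℕ → ℕ) (Y (f, n) = 0)`. -/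
def SigmaInd : Prop :=
  ∀ Y : M.El (T1 ⇒ T0 ⇒ T0),
    (∃ f : M.El T1, Y f M.zero = M.zero) →
    (∀ n : M.El T0, (∃ f : M.El T1, Y f n = M.zero) → ∃ f : M.El T1, Y f (M.succ n) = M.zero) →
    ∀ n : M.El T0, ∃ f : M.El T1, Y f n = M.zero

/-- Feferman's projection principle.  A set of numbers is given by its characteristic function. -/
def Boot : Prop :=
  ∀ Y : M.El (T1 ⇒ T0 ⇒ T0), ∃ X : M.El T1, (∀ n, X n = M.zero ∨ X n = M.one) ∧
    ∀ n : M.El T0, X n = M.one ↔ ∃ f : M.El T1, Y f n = M.zero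

/-! Arithmetic of numbers -/

/-- For `f : T1`, the functional `a, i ↦ f a`. -/
def iterStep (f : M.El T1) : M.El (T0 ⇒ T0 ⇒ T0) :=
  M.S T0 T0 (T0 ⇒ T0) (M.K (T0 ⇒ T0 ⇒ T0) T0 (M.K T0 T0)) f

/-- The function `y ↦ x + y`. -/
def addFun (x : M.El T0) : M.El T1 := M.R x (M.iterStep M.succ)

/-- The function `y ↦ x * y`. -/
def mulFun (x : M.El T0) : M.El T1 := M.R M.zero (M.iterStep (M.addFun x))

/-- The function `n ↦ 2 ^ n`. -/
def twoPow : M.El T1 := M.R M.one (M.iterStep (M.mulFun (M.succ M.one)))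

variable {M}

def add (x y : M.El T0) : M.El T0 := M.addFun x y

def mul (x y : M.El T0) : M.El T0 := M.mulFun x y

def le (x y : M.El T0) : Prop := ∃ z, add x z = y

/-- The pairing function `(x, y) ↦ (x + y)² + x`. -/
def pair (x y : M.El T0) : M.El T0 := add (mul (add x y) (add x y)) x

/-! Rational numbers -/

/-- A presentation `(pos - neg) / den` of a rational number (where `den` is not zero). -/
structure Fraction (M : TypeStructure.{u}) where
  pos : M.El T0
  neg : M.El T0
  den : M.El T0

namespace Fraction

def le (p q : Fraction M) : Prop :=
  TypeStructure.le
    (TypeStructure.add (mul p.pos q.den) (mul q.neg p.den))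
    (TypeStructure.add (mul q.pos p.den) (mul p.neg q.den))

def add (p q : Fraction M) : Fraction M where
  pos := TypeStructure.add (mul p.pos q.den) (mul q.pos p.den)
  neg := TypeStructure.add (mul p.neg q.den) (mul q.neg p.den)
  den := mul p.den q.den

/-- Multiplication by a number. -/
def smul (n : M.El T0) (p : Fraction M) : Fraction M where
  pos := mul n p.pos
  neg := mul n p.neg
  den := p.den

/-- The rational number given by a number `n`. -/
def ofNumber (n : M.El T0) : Fraction M := ⟨n, M.zero, M.one⟩

/-- The rational number `1 / 2 ^ k`. -/
def invTwoPow (k : M.El T0) : Fraction M := ⟨M.one, M.zero, M.twoPow k⟩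

open Classical in
/-- The rational number coded by a number: `((a, b), c)` codes `(a - b) / (c + 1)`, and a number that
does not have this form codes `0`. -/
noncomputable def ofCode (c : M.El T0) : Fraction M :=
  if h : ∃ t : M.El T0 × M.El T0 × M.El T0, c = pair (pair t.1 t.2.1) t.2.2 then
    ⟨h.choose.1, h.choose.2.1, M.succ h.choose.2.2⟩
  else ofNumber M.zero

end Fraction

/-! Real numbers: sequences `q` of rationals with `|q n - q (n + m)| ≤ 1 / 2 ^ n`. -/

/-- Sequences of rational numbers, indexed by the numbers of `M`. -/
abbrev RatSeq (M : TypeStructure.{u}) := M.El T0 → Fraction M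

namespace RatSeq

/-- The order of the real numbers. -/
def le (u v : RatSeq M) : Prop :=
  ∀ k, (u k).le ((v k).add ((Fraction.invTwoPow k).add (Fraction.invTwoPow k)))

def lt (u v : RatSeq M) : Prop := ¬ le v u

/-- Equality of real numbers. -/
def eq (u v : RatSeq M) : Prop := le u v ∧ le v u

/-- The sum of real numbers; the shift of the index keeps the rate of convergence. -/
def add (u v : RatSeq M) : RatSeq M := fun k => (u (M.succ k)).add (v (M.succ k))

/-- The product of a real number by a number `n`; as `n ≤ 2 ^ n`, the shift of the index keeps
the rate of convergence. -/
def smul (n : M.El T0) (u : RatSeq M) : RatSeq M :=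
  fun k => (u (TypeStructure.add k n)).smul n

def ofNumber (n : M.El T0) : RatSeq M := fun _ => Fraction.ofNumber n

/-- The real number `1 / 2 ^ k`. -/
def invTwoPow (k : M.El T0) : RatSeq M := fun _ => Fraction.invTwoPow k

end RatSeq

/-- The sequence of rational numbers coded by an element of type `T1`. -/
noncomputable def seq (a : M.El T1) : RatSeq M := fun n => Fraction.ofCode (a n)

/-- `a` codes a real number. -/
def IsReal (a : M.El T1) : Prop :=
  ∀ n m : M.El T0,
    (seq a n).le ((seq a (add n m)).add (Fraction.invTwoPow n)) ∧
    (seq a (add n m)).le ((seq a n).add (Fraction.invTwoPow n))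

/-! Metric spaces `(ℕ^ℕ, d)`; the points are the elements of type `T1`. -/

/-- `x` belongs to the set of points with characteristic function `X`. -/
def Mem (x : M.El T1) (X : M.El (T1 ⇒ T0)) : Prop := X x = M.one

/-- The points `x` and `y` are equal with respect to the relation with characteristic function `e`. -/
def Same (e : M.El (T1 ⇒ T1 ⇒ T0)) (x y : M.El T1) : Prop := e x y = M.one

/-- `d` is a metric on `ℕ^ℕ`, where the equality of points is the equivalence relation `e`. -/
structure IsMetric (e : M.El (T1 ⇒ T1 ⇒ T0)) (d : M.El (T1 ⇒ T1 ⇒ T1)) : Prop where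
  char_fun : ∀ x y, e x y = M.zero ∨ e x y = M.one
  equiv : Equivalence (Same e)
  isReal : ∀ x y, IsReal (d x y)
  congr : ∀ x x' y y', Same e x x' → Same e y y' → (seq (d x y)).eq (seq (d x' y'))
  eq_zero_iff : ∀ x y, (seq (d x y)).eq (RatSeq.ofNumber M.zero) ↔ Same e x y
  nonneg : ∀ x y, (RatSeq.ofNumber M.zero).le (seq (d x y))
  symm : ∀ x y, (seq (d x y)).eq (seq (d y x))
  triangle : ∀ x y z, (seq (d x y)).le ((seq (d x z)).add (seq (d z y)))

/-- `f` is a function from the space to the real numbers: it respects the equality of points. -/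
def IsRealFunction (e : M.El (T1 ⇒ T1 ⇒ T0)) (f : M.El (T1 ⇒ T1)) : Prop :=
  (∀ x, IsReal (f x)) ∧ ∀ x y, Same e x y → (seq (f x)).eq (seq (f y))

/-- `f` is a function from the space to `[0,1]`. -/
def IsUnitFunction (e : M.El (T1 ⇒ T1 ⇒ T0)) (f : M.El (T1 ⇒ T1)) : Prop :=
  IsRealFunction e f ∧
    ∀ x, (RatSeq.ofNumber M.zero).le (seq (f x)) ∧ (seq (f x)).le (RatSeq.ofNumber M.one)

/-- `X` is (the characteristic function of) a subset of the space. -/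
def IsSubset (e : M.El (T1 ⇒ T1 ⇒ T0)) (X : M.El (T1 ⇒ T0)) : Prop :=
  (∀ x, X x = M.zero ∨ X x = M.one) ∧ ∀ x y, Same e x y → X x = X y

/-- `y` is in the open ball with centre `x` and radius `1 / 2 ^ k`. -/
def InBall (d : M.El (T1 ⇒ T1 ⇒ T1)) (x : M.El T1) (k : M.El T0) (y : M.El T1) : Prop :=
  (seq (d x y)).lt (RatSeq.invTwoPow k)

/-- `y` is in the closed ball with centre `x` and radius `1 / 2 ^ k`. -/
def InClosedBall (d : M.El (T1 ⇒ T1 ⇒ T1)) (x : M.El T1) (k : M.El T0) (y : M.El T1) : Prop :=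
  (seq (d x y)).le (RatSeq.invTwoPow k)

/-- The set `X` is open. -/
def IsOpenSet (d : M.El (T1 ⇒ T1 ⇒ T1)) (X : M.El (T1 ⇒ T0)) : Prop :=
  ∀ x, Mem x X → ∃ k, ∀ y, InBall d x k y → Mem y X

/-- `f` is continuous in the sense of `ε` and `δ`. -/
def IsContinuous (d : M.El (T1 ⇒ T1 ⇒ T1)) (f : M.El (T1 ⇒ T1)) : Prop :=
  ∀ x k, ∃ n, ∀ y, InBall d x n y →
    (seq (f x)).lt ((seq (f y)).add (RatSeq.invTwoPow k)) ∧
    (seq (f y)).lt ((seq (f x)).add (RatSeq.invTwoPow k))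

/-- `f` is Lipschitz continuous. -/
def IsLipschitz (d : M.El (T1 ⇒ T1 ⇒ T1)) (f : M.El (T1 ⇒ T1)) : Prop :=
  ∃ c : M.El T0, ∀ x y,
    (seq (f x)).le ((seq (f y)).add ((seq (d x y)).smul c)) ∧
    (seq (f y)).le ((seq (f x)).add ((seq (d x y)).smul c))

/-! Compactness -/

/-- The set `X` is finite: for some `n`, among any `n + 1` pairwise different points, one is not in
`X`.  The points `w 0, …, w n` of a finite sequence are given by an element `w` of type `T0 ⇒ T1`. -/
def IsFinite (e : M.El (T1 ⇒ T1 ⇒ T0)) (X : M.El (T1 ⇒ T0)) : Prop :=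
  ∃ n : M.El T0, ∀ w : M.El (T0 ⇒ T1),
    (∀ i j, le i n → le j n → i ≠ j → ¬ Same e (w i) (w j)) →
    ∃ i, le i n ∧ ¬ Mem (w i) X

/-- The point `x` is a limit point of `X`. -/
def IsLimitPoint (e : M.El (T1 ⇒ T1 ⇒ T0)) (d : M.El (T1 ⇒ T1 ⇒ T1)) (X : M.El (T1 ⇒ T0))
    (x : M.El T1) : Prop :=
  ∀ k, ∃ y, Mem y X ∧ ¬ Same e x y ∧ InBall d x k y

/-- Every sequence has a convergent subsequence. -/
def SequentiallyCompact (d : M.El (T1 ⇒ T1 ⇒ T1)) : Prop :=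
  ∀ s : M.El (T0 ⇒ T1), ∃ g : M.El T1, (∀ n, le (M.succ (g n)) (g (M.succ n))) ∧
    ∃ x : M.El T1, ∀ k, ∃ m, ∀ n, le m n → InBall d x k (s (g n))

/-- Every infinite subset has a limit point. -/
def LimitPointCompact (e : M.El (T1 ⇒ T1 ⇒ T0)) (d : M.El (T1 ⇒ T1 ⇒ T1)) : Prop :=
  ∀ X : M.El (T1 ⇒ T0), IsSubset e X → ¬ IsFinite e X → ∃ x, IsLimitPoint e d X x

/-- Every sequence of open sets that covers the space has an initial segment that covers it. -/
def CountablyCompact (e : M.El (T1 ⇒ T1 ⇒ T0)) (d : M.El (T1 ⇒ T1 ⇒ T1)) : Prop :=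
  ∀ O : M.El (T0 ⇒ T1 ⇒ T0), (∀ n, IsSubset e (O n) ∧ IsOpenSet d (O n)) →
    (∀ x, ∃ n, Mem x (O n)) → ∃ m, ∀ x, ∃ n, le n m ∧ Mem x (O n)

/-- For each function `r` from the space to the positive reals there is a finite sequence of points
`w 0, …, w k` such that the open balls with centre `w i` and radius `r (w i)` cover the space. -/
def OpenCoverCompact (e : M.El (T1 ⇒ T1 ⇒ T0)) (d : M.El (T1 ⇒ T1 ⇒ T1)) : Prop :=
  ∀ r : M.El (T1 ⇒ T1), IsRealFunction e r → (∀ x, (RatSeq.ofNumber M.zero).lt (seq (r x))) →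
    ∃ (k : M.El T0) (w : M.El (T0 ⇒ T1)),
      ∀ y, ∃ i, le i k ∧ (seq (d (w i) y)).lt (seq (r (w i)))

/-- The four notions of compactness. -/
inductive Compactness
  | sequential
  | limitPoint
  | countable
  | openCover

/-- The space is compact in the given sense. -/
def IsCompactSpace (c : Compactness) (e : M.El (T1 ⇒ T1 ⇒ T0)) (d : M.El (T1 ⇒ T1 ⇒ T1)) : Prop :=
  match c with
  | .sequential => SequentiallyCompact d
  | .limitPoint => LimitPointCompact e d
  | .countable => CountablyCompact e d
  | .openCover => OpenCoverCompact e d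

/-! The supremum principles -/

/-- The real number `a` is the supremum (least upper bound) of `f` on the points satisfying `A`. -/
def IsSup (A : M.El T1 → Prop) (f : M.El (T1 ⇒ T1)) (a : M.El T1) : Prop :=
  IsReal a ∧ (∀ z, A z → (seq (f z)).le (seq a)) ∧
    ∀ b : M.El T1, IsReal b → (∀ z, A z → (seq (f z)).le (seq b)) → (seq a).le (seq b)

variable (M)

/-- For compact `(ℕ^ℕ, d)`, continuous `f : ℕ^ℕ → [0,1]` and `x`, there is a sequence of real numbers
whose entry `n` is the supremum of `f` on the closed ball with centre `x` and radius `1 / 2 ^ n`. -/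
def SupremumPrinciple (c : Compactness) : Prop :=
  ∀ (e : M.El (T1 ⇒ T1 ⇒ T0)) (d : M.El (T1 ⇒ T1 ⇒ T1)), IsMetric e d → IsCompactSpace c e d →
    ∀ f : M.El (T1 ⇒ T1), IsUnitFunction e f → IsContinuous d f →
      ∀ x : M.El T1, ∃ y : M.El (T0 ⇒ T1), ∀ n, IsSup (InClosedBall d x n) f (y n)

/-- The same principle for Lipschitz continuous functions only. -/
def LipschitzSupremumPrinciple (c : Compactness) : Prop :=
  ∀ (e : M.El (T1 ⇒ T1 ⇒ T0)) (d : M.El (T1 ⇒ T1 ⇒ T1)), IsMetric e d → IsCompactSpace c e d →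
    ∀ f : M.El (T1 ⇒ T1), IsUnitFunction e f → IsLipschitz d f →
      ∀ x : M.El T1, ∃ y : M.El (T0 ⇒ T1), ∀ n, IsSup (InClosedBall d x n) f (y n)

/-- For compact `(ℕ^ℕ, d)` and a sequence of continuous functions `ℕ^ℕ → [0,1]`, the sequence of
their suprema exists. -/
def SequentialSupremumPrinciple (c : Compactness) : Prop :=
  ∀ (e : M.El (T1 ⇒ T1 ⇒ T0)) (d : M.El (T1 ⇒ T1 ⇒ T1)), IsMetric e d → IsCompactSpace c e d →
    ∀ f : M.El (T0 ⇒ T1 ⇒ T1), (∀ n, IsUnitFunction e (f n) ∧ IsContinuous d (f n)) →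
      ∃ y : M.El (T0 ⇒ T1), ∀ n, IsSup (fun _ => True) (f n) (y n)

end TypeStructure

end HigherOrderRM

/-! The proof takes place inside a model. `Internal` says that a function between carriers is given
by an element of the model, and `Dec` that a predicate has such a characteristic function. Their
instances carry out combinatory abstraction, so `infer_instance` checks definability. With `∃²`
number quantifiers preserve `Dec`, so induction and search apply to all arithmetical predicates with
parameters. The numbers then form an ordered semiring, and rational estimates are made in its
ordered field of fractions.

From `BOOT` to suprema (`Boot.exists_sup`): the relation "some `z` in the `n`-th set has `f n z > j
/ 2 ^ k`" is a projection, so `BOOT` makes it decidable. For given `n` and `k`, search finds the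
last `j` for which it holds. The numbers `j / 2 ^ k` converge at the required rate to the supremum.

From suprema to `BOOT`: let a point code a pair `(n, f)`, with index `n + 1` if `Y f n = 0` and
index `0` otherwise. Identify points of equal index and place index `m ≠ 0` at distance `2 ^ (-m)`
from the point of index `0`, and two points of different index at the larger of their distances from
it. The space is in effect `{0} ∪ {2 ^ (-m) : m is attained}`. A ball around the limit point misses
only boundedly many indices, and `Σ`-induction treats these as a finite set, by the pigeonhole
principle and an enumeration of the attained values; this gives all four kinds of compactness
(`IsIndexSpace.isCompactSpace`). Suprema now detect attained indices: that of the characteristic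
function of index `n + 1` is `1` or `0`, and that of the distance from the limit point, over the
closed ball of radius `2 ^ (-(n + 1))`, is this radius or at most half of it. Comparing a real with
a rational is arithmetical, so the projection is decidable (the two lemmas `dec_exists`), which
`boot_of_dec_exists` turns into `BOOT`. -/

namespace HigherOrderRM.TypeStructure

/-! Functions definable in a model by combinators -/

/-- Contexts: nonempty lists of variables of finite type, as left-nested products of carriers. -/
class Ctx (M : outParam TypeStructure.{u}) (X : Type u) where
  arr : Ty → Ty
  ap : ∀ {τ : Ty}, M.El (arr τ) → X → M.El τ
  exists_const : ∀ {τ : Ty} (c : M.El τ), ∃ f, ∀ x, ap f x = c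
  exists_app : ∀ {σ τ : Ty} (f : M.El (arr (σ ⇒ τ))) (g : M.El (arr σ)),
    ∃ h, ∀ x, ap h x = ap f x (ap g x)

section Internal

set_option linter.unusedSectionVars false
set_option linter.style.haveILetI false

variable {M : TypeStructure.{u}} [hM : Fact M.ModelsACA]

theorem rca : M.ModelsRCA := hM.out.1

instance ctxEl (σ : Ty) : Ctx M (M.El σ) where
  arr τ := σ ⇒ τ
  ap f x := f x
  exists_const c := ⟨M.K _ _ c, fun x => rca.K_eq c x⟩
  exists_app f g := ⟨M.S _ _ _ f g, fun x => rca.S_eq f g x⟩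

/-- A function on the longer context is curried, so both closure properties come from applying those
of the shorter context to the elements `K` and `S`: this is iterated bracket abstraction. -/
instance ctxProd (X : Type u) [Ctx M X] (σ : Ty) : Ctx M (X × M.El σ) where
  arr τ := Ctx.arr X (σ ⇒ τ)
  ap f x := Ctx.ap f x.1 x.2
  exists_const c := by
    obtain ⟨f, hf⟩ := Ctx.exists_const (X := X) (M.K _ σ c)
    exact ⟨f, fun x => by rw [hf, rca.K_eq]⟩
  exists_app {ρ τ} f g := by
    obtain ⟨s, hs⟩ := Ctx.exists_const (X := X) (M.S σ ρ τ)
    obtain ⟨a, ha⟩ := Ctx.exists_app s f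
    obtain ⟨b, hb⟩ := Ctx.exists_app a g
    exact ⟨b, fun x => by rw [hb, ha, hs, rca.S_eq]⟩

/-- `F` is given by a closed term with parameters from the model. -/
class Internal {X : Type u} [Ctx M X] {τ : Ty} (F : X → M.El τ) : Prop where
  out : ∃ f, ∀ x, Ctx.ap f x = F x

variable {X : Type u} [Ctx M X] {ρ σ τ : Ty}

/-- These instances follow the formation of terms: constants, application, variables and, below,
abstraction. Instance search along the syntax thus replaces the construction of combinator terms. -/
instance Internal.const (c : M.El τ) : Internal (fun _ : X => c) := ⟨Ctx.exists_const c⟩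

instance Internal.app (F : X → M.El (σ ⇒ τ)) (G : X → M.El σ) [hF : Internal F]
    [hG : Internal G] : Internal (fun x => F x (G x)) := by
  obtain ⟨f, hf⟩ := hF.out
  obtain ⟨g, hg⟩ := hG.out
  obtain ⟨h, hh⟩ := Ctx.exists_app f g
  exact ⟨h, fun x => by rw [hh, hf, hg]⟩

theorem exists_identity (M : TypeStructure.{u}) [Fact M.ModelsACA] (σ : Ty) :
    ∃ f : M.El (σ ⇒ σ), ∀ x, f x = x :=
  ⟨M.S σ (σ ⇒ σ) σ (M.K σ (σ ⇒ σ)) (M.K σ σ), fun x => by rw [rca.S_eq, rca.K_eq]⟩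

instance Internal.app_const (f : M.El (σ ⇒ τ)) : Internal (fun x => f x) := ⟨f, fun _ => rfl⟩

instance Internal.var : Internal (fun x : M.El σ => x) := ⟨exists_identity M σ⟩

instance Internal.var0 : Internal (fun x : X × M.El σ => x.2) := by
  obtain ⟨i, hi⟩ := exists_identity M σ
  obtain ⟨f, hf⟩ := Ctx.exists_const (X := X) i
  exact ⟨f, fun x => (congrArg (fun t => M.app t x.2) (hf x.1)).trans (hi _)⟩

theorem Internal.weaken {F : X → M.El τ} (hF : Internal F) :
    Internal (fun x : X × M.El σ => F x.1) := by
  obtain ⟨f, hf⟩ := hF.out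
  obtain ⟨k, hk⟩ := Ctx.exists_const (X := X) (M.K τ σ)
  obtain ⟨h, hh⟩ := Ctx.exists_app k f
  exact ⟨h, fun x => by
    change M.app (Ctx.ap h x.1) x.2 = _
    rw [hh, hk, rca.K_eq, hf]⟩

section Variables

variable {σ₁ σ₂ σ₃ σ₄ : Ty}

instance Internal.base1 : Internal (fun x : M.El σ × M.El σ₁ => x.1) := Internal.var.weaken

instance Internal.base2 : Internal (fun x : (M.El σ × M.El σ₁) × M.El σ₂ => x.1.1) :=
  Internal.base1.weaken

instance Internal.base3 : Internal (fun x : ((M.El σ × M.El σ₁) × M.El σ₂) × M.El σ₃ => x.1.1.1) :=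
  Internal.base2.weaken

instance Internal.base4 :
    Internal (fun x : (((M.El σ × M.El σ₁) × M.El σ₂) × M.El σ₃) × M.El σ₄ => x.1.1.1.1) :=
  Internal.base3.weaken

instance Internal.var1 : Internal (fun x : (X × M.El σ) × M.El σ₁ => x.1.2) :=
  Internal.var0.weaken

instance Internal.var2 : Internal (fun x : ((X × M.El σ) × M.El σ₁) × M.El σ₂ => x.1.1.2) :=
  Internal.var1.weaken

end Variables

theorem El.nonempty (M : TypeStructure.{u}) : ∀ σ : Ty, Nonempty (M.El σ)
  | .nat => ⟨M.zero⟩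
  | .arr σ τ => (El.nonempty M τ).map fun c => M.K τ σ c

open Classical in
/-- The element of type `σ ⇒ τ` given by a function, if there is one. -/
noncomputable def lam (F : M.El σ → M.El τ) : M.El (σ ⇒ τ) :=
  if h : ∃ f : M.El (σ ⇒ τ), ∀ x, f x = F x then h.choose else (El.nonempty M _).some

theorem lam_app (F : M.El σ → M.El τ) [hF : Internal F] (x : M.El σ) : lam F x = F x := by
  have h : ∃ f : M.El (σ ⇒ τ), ∀ x, f x = F x := hF.out
  rw [lam, dif_pos h]
  exact h.choose_spec x

theorem lam_eq {F : M.El σ → M.El τ} {f : M.El (σ ⇒ τ)} (h : ∀ x, f x = F x) : lam F = f :=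
  haveI : Internal F := ⟨f, h⟩
  rca.ext _ _ fun x => by rw [lam_app, h]

/-- Contexts are curried, so the element witnessing definability with one more variable also
witnesses the abstraction, by extensionality. -/
instance Internal.lam (F : X → M.El σ → M.El τ)
    [hF : Internal (fun p : X × M.El σ => F p.1 p.2)] :
    Internal (fun x => lam (fun a => F x a)) := by
  obtain ⟨f, hf⟩ := hF.out
  exact ⟨f, fun x => (lam_eq fun a => hf (x, a)).symm⟩

/-- Sections of definable functions are definable. -/
theorem Internal.section (F : X → M.El σ → M.El τ)
    [hF : Internal (fun p : X × M.El σ => F p.1 p.2)] (x : X) : Internal (fun a => F x a) := by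
  obtain ⟨f, hf⟩ := hF.out
  exact ⟨Ctx.ap f x, fun a => hf (x, a)⟩

/-! Definable predicates -/

open Classical in
/-- The truth value of a proposition, where `0` stands for truth. -/
noncomputable def ind (M : TypeStructure.{u}) (P : Prop) : M.El T0 := if P then M.zero else M.one

theorem one_ne_zero' : M.one ≠ M.zero := rca.succ_ne_zero _

theorem ind_eq_zero {P : Prop} : ind M P = M.zero ↔ P := by
  unfold ind
  split_ifs with h <;> simp [h, one_ne_zero']

theorem ind_congr {P : Prop} {n : M.El T0} (h : n = M.zero ∨ n = M.one) (h' : n = M.zero ↔ P) :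
    n = ind M P := by
  unfold ind
  split_ifs with hP
  · exact h'.2 hP
  · exact h.resolve_left fun hn => hP (h'.1 hn)

/-- `A` has a definable characteristic function. -/
class Dec {X : Type u} [Ctx M X] (A : X → Prop) : Prop where
  out : Internal (fun x => ind M (A x))

/-- The composition with a definable function of one variable. -/
theorem Internal.comp (F : M.El ρ → M.El τ) [hF : Internal F] (G : X → M.El ρ) [Internal G] :
    Internal (fun x => F (G x)) := by
  obtain ⟨c, hc⟩ : ∃ c : M.El (ρ ⇒ τ), ∀ a, c a = F a := hF.out
  simp_rw [← hc]
  infer_instance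

/-- The composition with a definable function of two variables. -/
theorem Internal.comp₂ (F : M.El ρ → M.El σ → M.El τ)
    [hF : Internal (fun p : M.El ρ × M.El σ => F p.1 p.2)] (G : X → M.El ρ) (H : X → M.El σ)
    [Internal G] [Internal H] : Internal (fun x => F (G x) (H x)) := by
  obtain ⟨c, hc⟩ : ∃ c : M.El (ρ ⇒ σ ⇒ τ), ∀ p : M.El ρ × M.El σ, c p.1 p.2 = F p.1 p.2 := hF.out
  have : ∀ a b, F a b = c a b := fun a b => (hc (a, b)).symm
  simp_rw [this]
  infer_instance

/-- The composition with a definable function of three variables. -/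
theorem Internal.comp₃ {υ : Ty} (F : M.El ρ → M.El σ → M.El υ → M.El τ)
    [hF : Internal (fun p : (M.El ρ × M.El σ) × M.El υ => F p.1.1 p.1.2 p.2)] (G : X → M.El ρ)
    (H : X → M.El σ) (I : X → M.El υ) [Internal G] [Internal H] [Internal I] :
    Internal (fun x => F (G x) (H x) (I x)) := by
  obtain ⟨c, hc⟩ : ∃ c : M.El (ρ ⇒ σ ⇒ υ ⇒ τ), ∀ p : (M.El ρ × M.El σ) × M.El υ,
    c p.1.1 p.1.2 p.2 = F p.1.1 p.1.2 p.2 := hF.out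
  have : ∀ a b d, F a b d = c a b d := fun a b d => (hc ((a, b), d)).symm
  simp_rw [this]
  infer_instance

/-- The sequence with first entry `a`, followed by `f`. -/
noncomputable def cons (a : M.El T0) (f : M.El T1) : M.El T1 :=
  M.R a (lam fun _ => lam fun n => f n)

theorem cons_zero (a : M.El T0) (f : M.El T1) : cons a f M.zero = a := rca.R_zero _ _

theorem cons_succ (a : M.El T0) (f : M.El T1) (n : M.El T0) : cons a f (M.succ n) = f n := by
  rw [cons, rca.R_succ, lam_app, lam_app]

instance Internal.cons (F : X → M.El T0) (G : X → M.El T1) [Internal F] [Internal G] :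
    Internal (fun x => cons (F x) (G x)) :=
  haveI : Internal fun p : M.El T0 × M.El T1 => TypeStructure.cons p.1 p.2 := by
    unfold TypeStructure.cons
    infer_instance
  Internal.comp₂ TypeStructure.cons F G

/-- The quantifier-free axiom of choice, for terms in the sense of `Internal`. -/
theorem exists_choice (A : M.El T1 → M.El T0 → Prop)
    (hA : QuantifierFree {F : M.El T1 × M.El T0 → M.El T0 | Internal F} fun p => A p.1 p.2)
    (h : ∀ f, ∃ n, A f n) : ∃ Φ : M.El (T1 ⇒ T0), ∀ f, A f (Φ f) := by
  refine rca.qf_ac (fun p => A p.1 p.2) ?_ h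
  have : {F : M.El T1 × M.El T0 → M.El T0 | Internal F} ⊆
      {s | ∃ Y : M.El (T1 ⇒ T0 ⇒ T0), s = fun p => Y p.1 p.2} := fun F hF => by
    obtain ⟨Y, hY⟩ := (show Internal F from hF).out
    exact ⟨Y, funext fun p => (hY p).symm⟩
  unfold QFFunctionNumber
  generalize (fun p : M.El T1 × M.El T0 => A p.1 p.2) = B at hA
  induction hA with
  | eq s t hs ht => exact .eq s t (this hs) (this ht)
  | neg A _ h => exact .neg A h
  | conj A B _ _ h h' => exact .conj A B h h'
  | disj A B _ _ h h' => exact .disj A B h h'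
  | impl A B _ _ h h' => exact .impl A B h h'

/-- Every quantifier-free predicate of functions has a characteristic function. -/
theorem exists_ind (A : M.El T1 → Prop)
    (hA : QuantifierFree {F : M.El T1 × M.El T0 → M.El T0 | Internal F} fun p => A p.1) :
    ∃ Φ : M.El (T1 ⇒ T0), ∀ f, Φ f = ind M (A f) := by
  -- The only number related to `f` is the truth value of `A f`, so a choice functional is the
  -- characteristic function.
  obtain ⟨Φ, hΦ⟩ := exists_choice (fun f n => (A f ∧ n = M.zero) ∨ (¬ A f ∧ n = M.one))
    (.disj _ _ (.conj _ _ hA (.eq _ _ Internal.var0 (Internal.const _)))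
      (.conj _ _ (.neg _ hA) (.eq _ _ Internal.var0 (Internal.const _))))
    fun f => by by_cases h : A f <;> simp [h]
  refine ⟨Φ, fun f => ?_⟩
  rcases hΦ f with h | h
  · rw [h.2, ind, if_pos h.1]
  · rw [h.2, ind, if_neg h.1]

/-- Choice provides characteristic functions only for predicates of a function, so the two numbers
are packed into the first two entries of one. -/
instance Dec.eq (F G : X → M.El T0) [Internal F] [Internal G] : Dec (fun x => F x = G x) := by
  obtain ⟨Φ, hΦ⟩ := exists_ind (M := M) (fun f => f M.zero = f (M.succ M.zero))
    (.eq _ _ (show Internal _ from inferInstance) (show Internal _ from inferInstance))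
  have : ∀ x, ind M (F x = G x) = Φ (cons (F x) (cons (G x) (M.K _ _ M.zero))) := fun x => by
    rw [hΦ, cons_zero, cons_succ, cons_zero]
  exact ⟨by simp_rw [this]; infer_instance⟩

instance Dec.and (A B : X → Prop) [hA : Dec A] [hB : Dec B] : Dec (fun x => A x ∧ B x) := by
  obtain ⟨Φ, hΦ⟩ := exists_ind (M := M) (fun f => f M.zero = M.zero ∧ f (M.succ M.zero) = M.zero)
    (.conj _ _ (.eq _ _ (show Internal _ from inferInstance) (show Internal _ from inferInstance))
      (.eq _ _ (show Internal _ from inferInstance) (show Internal _ from inferInstance)))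
  have h1 := hA.out
  have h2 := hB.out
  have : ∀ x, ind M (A x ∧ B x) = Φ (cons (ind M (A x)) (cons (ind M (B x)) (M.K _ _ M.zero))) :=
    fun x => by rw [hΦ, cons_zero, cons_succ, cons_zero, ind_eq_zero, ind_eq_zero]
  exact ⟨by simp_rw [this]; infer_instance⟩

instance Dec.not (A : X → Prop) [hA : Dec A] : Dec (fun x => ¬ A x) := by
  have h1 := hA.out
  have h2 : Dec (fun x => ind M (A x) = M.one) := Dec.eq _ _
  have : ∀ x, (ind M (A x) = M.one) = ¬ A x := fun x => by
    unfold ind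
    split_ifs with h <;> simp [h, one_ne_zero'.symm]
  simpa only [this] using h2

theorem Dec.congr {A B : X → Prop} (hA : Dec A) (h : ∀ x, A x ↔ B x) : Dec B := by
  rwa [← funext fun x => propext (h x)]

instance Dec.or (A B : X → Prop) [Dec A] [Dec B] : Dec (fun x => A x ∨ B x) :=
  Dec.congr (A := fun x => ¬ (¬ A x ∧ ¬ B x)) inferInstance fun x => by tauto

instance Dec.imp (A B : X → Prop) [Dec A] [Dec B] : Dec (fun x => A x → B x) :=
  Dec.congr (A := fun x => ¬ (A x ∧ ¬ B x)) inferInstance fun x => by tauto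

instance Dec.const (P : Prop) : Dec (fun _ : X => P) := ⟨inferInstance⟩

theorem Dec.of_prod {A : X → M.El σ → Prop} (h : Dec (fun p : X × M.El σ => A p.1 p.2)) :
    Internal (fun x => TypeStructure.lam fun n => ind M (A x n)) ∧
      ∀ x n, TypeStructure.lam (fun n => ind M (A x n)) n = ind M (A x n) := by
  have h1 := h.out
  refine ⟨Internal.lam _, fun x n => ?_⟩
  haveI := Internal.section (fun x n => ind M (A x n)) x
  exact lam_app _ _

/-- The functional `∃²` is applied to the characteristic function of the matrix. This is what
extends induction and search from quantifier-free to arithmetical predicates. -/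
instance Dec.exists (A : X → M.El T0 → Prop) [hA : Dec (fun p : X × M.El T0 => A p.1 p.2)] :
    Dec (fun x => ∃ n, A x n) := by
  obtain ⟨E, hE, hE'⟩ := hM.out.2
  obtain ⟨h1, h2⟩ := hA.of_prod
  have : ∀ x, ind M (∃ n, A x n) = E (lam fun n => ind M (A x n)) := fun x => by
    refine (ind_congr (hE _) ?_).symm
    rw [← hE']
    simp_rw [h2, ind_eq_zero]
  exact ⟨by simp_rw [this]; infer_instance⟩

instance Dec.forall (A : X → M.El T0 → Prop) [Dec (fun p : X × M.El T0 => A p.1 p.2)] :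
    Dec (fun x => ∀ n, A x n) :=
  Dec.congr (A := fun x => ¬ ∃ n, ¬ A x n) inferInstance fun x => by simp

/-- Sections of definable predicates are definable. -/
theorem Dec.section (A : X → M.El σ → Prop) [hA : Dec (fun p : X × M.El σ => A p.1 p.2)] (x : X) :
    Dec (fun a => A x a) :=
  haveI := hA.out
  ⟨Internal.section (fun x a => ind M (A x a)) x⟩

/-- Induction for definable predicates, in terms of the constants of the language. -/
theorem dec_induction {A : M.El T0 → Prop} (hA : Dec A) (h0 : A M.zero)
    (hs : ∀ n, A n → A (M.succ n)) (n : M.El T0) : A n := by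
  obtain ⟨f, hf⟩ : ∃ f : M.El T1, ∀ n, f n = ind M (A n) := hA.out.out
  have : A = fun n => f n = M.K T0 T0 M.zero n := funext fun n => propext <| by
    rw [hf, rca.K_eq, ind_eq_zero]
  refine rca.qf_ind A ?_ h0 hs n
  rw [this]
  exact .eq _ _ ⟨f, rfl⟩ ⟨_, rfl⟩

/-- There is a search functional, which yields a zero of a function if there is one. -/
theorem exists_search : ∃ Φ : M.El (T1 ⇒ T0), ∀ (f : M.El T1) n, f n = M.zero → f (Φ f) = M.zero := by
  obtain ⟨E, hE, hE'⟩ := hM.out.2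
  -- The premise `E f = 0` expresses without a quantifier that `f` has a zero, and it makes the
  -- relation total, as choice demands.
  obtain ⟨Φ, hΦ⟩ := exists_choice (M := M) (fun f n => E f = M.zero → f n = M.zero)
    (.impl _ _ (.eq _ _ (show Internal _ from inferInstance) (show Internal _ from inferInstance))
      (.eq _ _ (show Internal _ from inferInstance) (show Internal _ from inferInstance)))
    fun f => by
      by_cases h : ∃ n, f n = M.zero
      · exact h.imp fun n hn _ => hn
      · exact ⟨M.zero, fun h' => (h ((hE' f).2 h')).elim⟩
  exact ⟨Φ, fun f n h => hΦ f ((hE' f).1 ⟨n, h⟩)⟩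

/-- A number satisfying `A`, if there is one; it depends definably on parameters. -/
noncomputable def pick (A : M.El T0 → Prop) : M.El T0 :=
  (exists_search (M := M)).choose (lam fun n => ind M (A n))

theorem pick_spec {A : M.El T0 → Prop} (hA : Dec A) (h : ∃ n, A n) : A (pick A) := by
  obtain ⟨n, hn⟩ := h
  haveI := hA.out
  have := (exists_search (M := M)).choose_spec (lam fun n => ind M (A n)) n
  rwa [lam_app, lam_app, ind_eq_zero, ind_eq_zero, imp_iff_right hn] at this

instance Internal.pick (A : X → M.El T0 → Prop) [hA : Dec (fun p : X × M.El T0 => A p.1 p.2)] :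
    Internal (fun x => pick fun n => A x n) := by
  have := hA.of_prod.1
  unfold TypeStructure.pick
  infer_instance

/-- Definition by cases is a search for the only number that fits the case at hand. -/
instance Internal.ite (A : X → Prop) {_ : ∀ x, Decidable (A x)} [Dec A] (F G : X → M.El T0)
    [Internal F] [Internal G] : Internal (fun x => if A x then F x else G x) := by
  have h : Dec (fun p : X × M.El T0 => (A p.1 ∧ p.2 = F p.1) ∨ (¬ A p.1 ∧ p.2 = G p.1)) := by
    have h1 : Dec (fun p : X × M.El T0 => A p.1) := ⟨(‹Dec A›.out).weaken⟩
    have h2 : Internal (fun p : X × M.El T0 => F p.1) := ‹Internal F›.weaken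
    have h3 : Internal (fun p : X × M.El T0 => G p.1) := ‹Internal G›.weaken
    infer_instance
  have h' : ∀ x, (if A x then F x else G x) =
      TypeStructure.pick fun n => (A x ∧ n = F x) ∨ (¬ A x ∧ n = G x) := fun x => by
    have := pick_spec (Dec.section (fun x n => (A x ∧ n = F x) ∨ (¬ A x ∧ n = G x)) x)
      (by by_cases hx : A x <;> simp [hx])
    split_ifs with hx
    · simpa [hx, eq_comm] using this
    · simpa [hx, eq_comm] using this
  simp_rw [h']
  infer_instance

end Internal

end HigherOrderRM.TypeStructure

namespace HigherOrderRM.TypeStructure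

/-! The ordered semiring of the numbers of a model -/

section Numbers

set_option linter.unusedSectionVars false
set_option linter.style.haveILetI false

variable {M : TypeStructure.{u}} [hM : Fact M.ModelsACA] {X : Type u} [Ctx M X]

theorem R_iterStep_succ (f : M.El T1) (x n : M.El T0) :
    M.R x (M.iterStep f) (M.succ n) = f (M.R x (M.iterStep f) n) := by
  rw [rca.R_succ, iterStep, rca.S_eq, rca.K_eq, rca.K_eq]

theorem add_zero' (x : M.El T0) : add x M.zero = x := rca.R_zero _ _

theorem add_succ' (x y : M.El T0) : add x (M.succ y) = M.succ (add x y) := R_iterStep_succ _ _ _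

theorem mul_zero' (x : M.El T0) : mul x M.zero = M.zero := rca.R_zero _ _

theorem mul_succ' (x y : M.El T0) : mul x (M.succ y) = add x (mul x y) := R_iterStep_succ _ _ _

instance Internal.add' (F G : X → M.El T0) [Internal F] [Internal G] :
    Internal (fun x => TypeStructure.add (F x) (G x)) := by
  unfold TypeStructure.add addFun
  infer_instance

instance Internal.mul' (F G : X → M.El T0) [Internal F] [Internal G] :
    Internal (fun x => TypeStructure.mul (F x) (G x)) := by
  have : Internal (fun p : M.El T0 × M.El T0 => TypeStructure.mul p.1 p.2) := by
    unfold TypeStructure.mul mulFun iterStep addFun iterStep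
    infer_instance
  exact Internal.comp₂ _ F G

instance Internal.add_const (c : M.El T0) : Internal (fun x => TypeStructure.add c x) :=
  Internal.add' (fun _ => c) fun x => x

instance Internal.mul_const (c : M.El T0) : Internal (fun x => TypeStructure.mul c x) :=
  Internal.mul' (fun _ => c) fun x => x

theorem zero_add' (x : M.El T0) : add M.zero x = x := by
  refine dec_induction (A := fun x => add M.zero x = x) inferInstance (add_zero' _) ?_ x
  intro n h
  rw [add_succ', h]

theorem succ_add' (x y : M.El T0) : add (M.succ x) y = M.succ (add x y) := by
  refine dec_induction (A := fun y => add (M.succ x) y = M.succ (add x y)) inferInstance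
    (by rw [add_zero', add_zero']) ?_ y
  intro n h
  rw [add_succ', h, add_succ']

theorem add_comm' (x y : M.El T0) : add x y = add y x := by
  refine dec_induction (A := fun y => add x y = add y x) inferInstance
    (by rw [add_zero', zero_add']) ?_ y
  intro n h
  rw [add_succ', h, succ_add']

theorem add_assoc' (x y z : M.El T0) : add (add x y) z = add x (add y z) := by
  refine dec_induction (A := fun z => add (add x y) z = add x (add y z)) inferInstance
    (by rw [add_zero', add_zero']) ?_ z
  intro n h
  rw [add_succ', h, add_succ', add_succ']

instance : AddCommMonoid (M.El T0) where
  add := add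
  zero := M.zero
  add_assoc := add_assoc'
  add_comm := add_comm'
  zero_add := zero_add'
  add_zero := add_zero'
  nsmul := @nsmulRec _ ⟨M.zero⟩ ⟨add⟩

theorem zero_mul' (x : M.El T0) : mul M.zero x = M.zero := by
  refine dec_induction (A := fun x => mul M.zero x = M.zero) inferInstance (mul_zero' _) ?_ x
  intro n h
  rw [mul_succ', h, add_zero']

theorem succ_mul' (x y : M.El T0) : mul (M.succ x) y = add y (mul x y) := by
  refine dec_induction (A := fun y => mul (M.succ x) y = add y (mul x y)) inferInstance
    (by rw [mul_zero', mul_zero', add_zero']) ?_ y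
  intro n h
  rw [mul_succ', h, mul_succ', succ_add', succ_add']
  exact congrArg _ (add_left_comm x n (mul x n))

theorem mul_comm' (x y : M.El T0) : mul x y = mul y x := by
  refine dec_induction (A := fun y => mul x y = mul y x) inferInstance
    (by rw [mul_zero', zero_mul']) ?_ y
  intro n h
  rw [mul_succ', h, succ_mul']

theorem mul_add' (x y z : M.El T0) : mul x (add y z) = add (mul x y) (mul x z) := by
  refine dec_induction (A := fun z => mul x (add y z) = add (mul x y) (mul x z)) inferInstance
    (by rw [mul_zero', add_zero', add_zero']) ?_ z
  intro n h
  rw [add_succ', mul_succ', h, mul_succ']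
  exact add_left_comm _ _ _

theorem mul_assoc' (x y z : M.El T0) : mul (mul x y) z = mul x (mul y z) := by
  refine dec_induction (A := fun z => mul (mul x y) z = mul x (mul y z)) inferInstance
    (by rw [mul_zero', mul_zero', mul_zero']) ?_ z
  intro n h
  rw [mul_succ', h, mul_succ', mul_add']

theorem mul_one' (x : M.El T0) : mul x M.one = x := by
  rw [one, mul_succ', mul_zero', add_zero']

instance : CommSemiring (M.El T0) where
  mul := mul
  one := M.one
  left_distrib := mul_add'
  right_distrib x y z := by
    change mul (add x y) z = add (mul x z) (mul y z)
    rw [mul_comm', mul_add', mul_comm', mul_comm' z]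
  zero_mul := zero_mul'
  mul_zero := mul_zero'
  mul_assoc := mul_assoc'
  one_mul x := (mul_comm' _ _).trans (mul_one' x)
  mul_one := mul_one'
  mul_comm := mul_comm'

theorem zero_eq : M.zero = 0 := rfl

theorem one_eq : M.one = 1 := rfl

theorem add_eq (x y : M.El T0) : add x y = x + y := rfl

theorem mul_eq (x y : M.El T0) : mul x y = x * y := rfl

theorem succ_eq (x : M.El T0) : M.succ x = x + 1 := by
  rw [← add_eq, ← one_eq, one, add_succ', add_zero']

instance Internal.add (F G : X → M.El T0) [Internal F] [Internal G] :
    Internal (fun x => F x + G x) := Internal.add' F G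

instance Internal.mul (F G : X → M.El T0) [Internal F] [Internal G] :
    Internal (fun x => F x * G x) := Internal.mul' F G

instance Internal.const_add (c : M.El T0) : Internal (fun x => c + x) := Internal.add' _ _

/-- Induction for definable predicates. -/
theorem Dec.induction {A : M.El T0 → Prop} (hA : Dec A) (h0 : A 0)
    (hs : ∀ n, A n → A (n + 1)) (n : M.El T0) : A n :=
  dec_induction hA h0 (fun n h => by rw [succ_eq]; exact hs n h) n

theorem add_one_ne_zero (n : M.El T0) : n + 1 ≠ 0 := by
  rw [← succ_eq]
  exact rca.succ_ne_zero n

theorem add_one_inj {m n : M.El T0} (h : m + 1 = n + 1) : m = n := by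
  rw [← succ_eq, ← succ_eq] at h
  exact rca.succ_inj m n h

theorem eq_zero_or_eq_add_one (n : M.El T0) : n = 0 ∨ ∃ m, n = m + 1 :=
  Dec.induction (A := fun n : M.El T0 => n = 0 ∨ ∃ m, n = m + 1) inferInstance (.inl rfl)
    (fun n _ => .inr ⟨n, rfl⟩) n

theorem add_right_cancel' {x y z : M.El T0} (h : x + z = y + z) : x = y := by
  refine Dec.induction (A := fun z => x + z = y + z → x = y) inferInstance ?_ ?_ z h
  · simp
  · intro n ih h
    rw [← add_assoc, ← add_assoc] at h
    exact ih (add_one_inj h)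

instance : IsCancelAdd (M.El T0) :=
  haveI : IsRightCancelAdd (M.El T0) := ⟨fun _ _ _ h => add_right_cancel' h⟩
  AddCommMagma.IsRightCancelAdd.toIsCancelAdd _

theorem eq_zero_of_add_eq_zero {x y : M.El T0} (h : x + y = 0) : x = 0 := by
  rcases eq_zero_or_eq_add_one x with rfl | ⟨m, rfl⟩
  · rfl
  · exact (add_one_ne_zero (m + y) (by rw [← h]; ring)).elim

theorem exists_add_or (x y : M.El T0) : (∃ z, x + z = y) ∨ ∃ z, y + z = x := by
  refine Dec.induction (A := fun y => (∃ z, x + z = y) ∨ ∃ z, y + z = x) inferInstance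
    (.inr ⟨x, zero_add x⟩) ?_ y
  rintro n (⟨z, rfl⟩ | ⟨z, rfl⟩)
  · exact .inl ⟨z + 1, by ring⟩
  · rcases eq_zero_or_eq_add_one z with rfl | ⟨m, rfl⟩
    · exact .inl ⟨1, by ring⟩
    · exact .inr ⟨m, by ring⟩

open Classical in
noncomputable instance : LinearOrder (M.El T0) where
  le := le
  le_refl x := ⟨0, add_zero x⟩
  le_trans := by
    rintro x _ _ ⟨a, rfl⟩ ⟨b, rfl⟩
    exact ⟨a + b, (add_assoc x a b).symm⟩
  le_antisymm := by
    rintro x _ ⟨a, rfl⟩ ⟨b, h⟩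
    have h : x + a + b = x := h
    rw [add_assoc] at h
    have := eq_zero_of_add_eq_zero (add_eq_left.1 h)
    subst this
    exact (add_zero x).symm
  le_total := exists_add_or
  toDecidableLE := Classical.decRel _

theorem le_eq (x y : M.El T0) : le x y = (x ≤ y) := rfl

theorem le_iff_exists (x y : M.El T0) : x ≤ y ↔ ∃ z, y = x + z := by
  simp_rw [eq_comm (a := y)]
  rfl

instance : CanonicallyOrderedAdd (M.El T0) where
  exists_add_of_le {x y} h := (le_iff_exists x y).1 h
  le_self_add _ y := (le_iff_exists _ _).2 ⟨y, rfl⟩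
  le_add_self _ y := (le_iff_exists _ _).2 ⟨y, add_comm _ _⟩

instance : IsOrderedCancelAddMonoid (M.El T0) where
  add_le_add_left a b h c := by
    obtain ⟨z, rfl⟩ := (le_iff_exists _ _).1 h
    exact (le_iff_exists _ _).2 ⟨z, by ring⟩
  le_of_add_le_add_left a b c h := by
    obtain ⟨z, hz⟩ := (le_iff_exists _ _).1 h
    exact (le_iff_exists _ _).2 ⟨z, add_left_cancel (hz.trans (add_assoc a b z))⟩

instance : Nontrivial (M.El T0) := ⟨1, 0, one_ne_zero'⟩

instance : NoZeroDivisors (M.El T0) where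
  eq_zero_or_eq_zero_of_mul_eq_zero {a b} h := by
    rcases eq_zero_or_eq_add_one b with rfl | ⟨m, rfl⟩
    · exact .inr rfl
    · exact .inl (eq_zero_of_add_eq_zero (y := a * m) (by rw [← h]; ring))

instance : IsStrictOrderedRing (M.El T0) :=
  haveI : MulPosStrictMono (M.El T0) := ⟨fun c hc a b h => by
    obtain ⟨z, rfl⟩ := (le_iff_exists _ _).1 h.le
    have hz : z ≠ 0 := by
      rintro rfl
      simp at h
    rw [add_mul]
    exact lt_add_of_pos_right _ (pos_iff_ne_zero.2 (mul_ne_zero hz hc.ne'))⟩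
  { zero_le_one := zero_le
    mul_lt_mul_of_pos_left := fun c hc a b h => by
      rw [mul_comm c, mul_comm c]
      exact mul_lt_mul_of_pos_right h hc }

theorem lt_add_one_iff' {m n : M.El T0} : m < n + 1 ↔ m ≤ n := by
  constructor
  · intro h
    by_contra! h'
    obtain ⟨z, rfl⟩ := (le_iff_exists _ _).1 h'.le
    rcases eq_zero_or_eq_add_one z with rfl | ⟨k, rfl⟩
    · simp at h'
    · have : n + 1 ≤ n + (k + 1) := by
        rw [← add_assoc, add_right_comm]
        exact le_self_add
      exact absurd h this.not_gt
  · intro h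
    exact h.trans_lt (lt_add_one n)

theorem add_one_le_iff' {m n : M.El T0} : m + 1 ≤ n ↔ m < n := by
  rw [← not_lt, lt_add_one_iff', not_le]

instance Dec.le (F G : X → M.El T0) [Internal F] [Internal G] : Dec (fun x => F x ≤ G x) := by
  have : Dec (fun p : M.El T0 × M.El T0 => p.1 ≤ p.2) := by
    simp_rw [le_iff_exists]
    infer_instance
  have h := this.out
  exact ⟨Internal.comp₂ (fun a b => ind M (a ≤ b)) F G⟩

instance Dec.lt (F G : X → M.El T0) [Internal F] [Internal G] : Dec (fun x => F x < G x) := by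
  simp_rw [← not_le]
  infer_instance

instance Dec.const_le (c : M.El T0) : Dec (fun x => c ≤ x) := Dec.le (fun _ => c) fun x => x

/-- A definable predicate with an instance has a least instance. -/
theorem Dec.exists_least {A : M.El T0 → Prop} (hA : Dec A) (h : ∃ n, A n) :
    ∃ n, A n ∧ ∀ m, m < n → ¬ A m := by
  by_contra! H
  obtain ⟨n, hn⟩ := h
  have hA' := hA.out
  have hd : Dec (fun n => ∀ m, m < n → ¬ A m) := by
    obtain ⟨f, hf⟩ : ∃ f : M.El T1, ∀ n, f n = ind M (A n) := hA.out.out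
    have : ∀ n, A n ↔ f n = M.zero := fun n => by rw [hf, ind_eq_zero]
    simp_rw [this]
    infer_instance
  have := Dec.induction hd (fun m hm => absurd hm not_lt_zero) (fun n ih m hm => by
    rcases (lt_add_one_iff'.1 hm).lt_or_eq with h | rfl
    · exact ih m h
    · intro hm
      obtain ⟨k, hk, hk'⟩ := H m hm
      exact ih k hk hk') (n + 1)
  exact this n (lt_add_one n) hn

/-- A definable predicate that holds at `0` and fails at `n` has a last instance before its first
failure. -/
theorem Dec.exists_step {A : M.El T0 → Prop} (hA : Dec A) (h0 : A 0) {n : M.El T0} (hn : ¬ A n) :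
    ∃ m, m < n ∧ A m ∧ ¬ A (m + 1) := by
  obtain ⟨k, hk, hk'⟩ := Dec.exists_least (A := fun n => ¬ A n) inferInstance ⟨n, hn⟩
  rcases eq_zero_or_eq_add_one k with rfl | ⟨m, rfl⟩
  · exact (hk h0).elim
  · refine ⟨m, ?_, not_not.1 (hk' m (lt_add_one m)), hk⟩
    by_contra! h
    exact hk' n (lt_add_one_iff'.2 h) hn

/-! Powers of two -/

theorem twoPow_zero : M.twoPow 0 = 1 := rca.R_zero _ _

theorem twoPow_add_one (n : M.El T0) : M.twoPow (n + 1) = 2 * M.twoPow n := by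
  rw [← succ_eq, twoPow, R_iterStep_succ, succ_eq, one_eq, one_add_one_eq_two]
  rfl

theorem twoPow_add (m n : M.El T0) : M.twoPow (m + n) = M.twoPow m * M.twoPow n := by
  refine Dec.induction (A := fun n => M.twoPow (m + n) = M.twoPow m * M.twoPow n) inferInstance
    ?_ ?_ n
  · rw [add_zero, twoPow_zero, mul_one]
  · intro n h
    rw [← add_assoc, twoPow_add_one, h, twoPow_add_one]
    ring

theorem lt_twoPow (n : M.El T0) : n < M.twoPow n := by
  refine Dec.induction (A := fun n => n < M.twoPow n) inferInstance ?_ ?_ n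
  · rw [twoPow_zero]
    exact zero_lt_one
  · intro n h
    rw [twoPow_add_one, two_mul]
    exact add_lt_add_of_lt_of_le h (by rw [← zero_add 1, add_one_le_iff']; exact h.pos)

theorem twoPow_pos (n : M.El T0) : 0 < M.twoPow n := (lt_twoPow n).pos

theorem twoPow_mono {m n : M.El T0} (h : m ≤ n) : M.twoPow m ≤ M.twoPow n := by
  obtain ⟨z, rfl⟩ := (le_iff_exists _ _).1 h
  rw [twoPow_add]
  exact le_mul_of_one_le_right' (by rw [← zero_add 1, add_one_le_iff']; exact twoPow_pos z)

/-! Pairing -/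

theorem pair_eq (x y : M.El T0) : pair x y = (x + y) * (x + y) + x := rfl

/-- With `s = x + y` the code lies between `s ^ 2` and `(s + 1) ^ 2`, the latter excluded; so it
determines `s`, then `x`, then `y`. -/
theorem pair_inj {x y x' y' : M.El T0} (h : pair x y = pair x' y') : x = x' ∧ y = y' := by
  have key : ∀ {s x s' x' : M.El T0}, x ≤ s → s * s + x = s' * s' + x' → s' ≤ s := by
    intro s x s' x' hx h
    by_contra! hs
    have h1 : (s + 1) * (s + 1) ≤ s' * s' := mul_le_mul' (add_one_le_iff'.2 hs) (add_one_le_iff'.2 hs)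
    have h2 : s * s + x < (s + 1) * (s + 1) := by
      rw [show (s + 1) * (s + 1) = s * s + (s + (s + 1)) by ring]
      gcongr
      exact hx.trans_lt ((lt_add_one s).trans_le le_add_self)
    exact absurd (h2.trans_le (h1.trans le_self_add)) h.not_lt
  rw [pair_eq, pair_eq] at h
  have hs : x + y = x' + y' :=
    le_antisymm (key le_self_add h.symm) (key le_self_add h)
  rw [hs] at h
  have hx := add_left_cancel h
  subst hx
  exact ⟨rfl, add_left_cancel hs⟩

instance Internal.pair (F G : X → M.El T0) [Internal F] [Internal G] :
    Internal (fun x => pair (F x) (G x)) := by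
  unfold TypeStructure.pair
  infer_instance

instance Internal.const_pair (c : M.El T0) : Internal (fun x => TypeStructure.pair c x) :=
  Internal.pair (fun _ => c) fun x => x

/-- The first component of a coded pair. -/
noncomputable def fst (c : M.El T0) : M.El T0 := pick fun a => ∃ b, c = pair a b

/-- The second component of a coded pair. -/
noncomputable def snd (c : M.El T0) : M.El T0 := pick fun b => ∃ a, c = pair a b

theorem fst_pair (a b : M.El T0) : fst (pair a b) = a := by
  obtain ⟨b', h⟩ := pick_spec (A := fun x => ∃ y, pair a b = pair x y) inferInstance ⟨a, b, rfl⟩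
  exact (pair_inj h).1.symm

theorem snd_pair (a b : M.El T0) : snd (pair a b) = b := by
  obtain ⟨b', h⟩ := pick_spec (A := fun y => ∃ x, pair a b = pair x y) inferInstance ⟨b, a, rfl⟩
  exact (pair_inj h).2.symm

instance Internal.fst (F : X → M.El T0) [Internal F] : Internal (fun x => fst (F x)) := by
  unfold TypeStructure.fst
  have : Internal (fun c : M.El T0 => TypeStructure.pick fun a => ∃ b, c = TypeStructure.pair a b) :=
    inferInstance
  exact Internal.comp (fun c : M.El T0 => TypeStructure.pick fun a => ∃ b, c = TypeStructure.pair a b) F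

instance Internal.snd (F : X → M.El T0) [Internal F] : Internal (fun x => snd (F x)) := by
  unfold TypeStructure.snd
  have : Internal (fun c : M.El T0 => TypeStructure.pick fun b => ∃ a, c = TypeStructure.pair a b) :=
    inferInstance
  exact Internal.comp (fun c : M.El T0 => TypeStructure.pick fun b => ∃ a, c = TypeStructure.pair a b) F

instance Internal.fst_var : Internal (fun c : M.El T0 => TypeStructure.fst c) :=
  Internal.fst fun c => c

instance Internal.snd_var : Internal (fun c : M.El T0 => TypeStructure.snd c) :=
  Internal.snd fun c => c

end Numbers

end HigherOrderRM.TypeStructure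

namespace HigherOrderRM

/-! The ordered field of fractions of an ordered semiring -/

section OrderedField

set_option linter.unusedSectionVars false
set_option linter.style.haveILetI false

variable (N : Type u) [CommSemiring N] [LinearOrder N] [IsStrictOrderedRing N]
  [CanonicallyOrderedAdd N] [NoZeroDivisors N]

/-- Two formal differences are equivalent if they have the same value. -/
def diffSetoid : Setoid (N × N) where
  r p q := p.1 + q.2 = q.1 + p.2
  iseqv :=
    { refl := fun _ => rfl
      symm := fun h => h.symm
      trans := fun {x y z} h h' => by
        apply add_right_cancel (b := y.2)
        rw [add_right_comm, h, add_right_comm, h', add_right_comm] }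

/-- The ring of differences of elements of `N`. -/
def Diff : Type u := Quotient (diffSetoid N)

variable {N}

namespace Diff

def mk (a b : N) : Diff N := Quotient.mk (diffSetoid N) (a, b)

theorem mk_eq_mk {a b c d : N} : mk a b = mk c d ↔ a + d = c + b :=
  ⟨fun h => Quotient.exact h, fun h => Quotient.sound h⟩

theorem ind {P : Diff N → Prop} (h : ∀ a b, P (mk a b)) (x : Diff N) : P x :=
  Quotient.ind (fun p => h p.1 p.2) x

instance : Add (Diff N) where
  add := Quotient.map₂ (fun p q => (p.1 + q.1, p.2 + q.2)) fun p p' h q q' h' => by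
    change p.1 + q.1 + (p'.2 + q'.2) = p'.1 + q'.1 + (p.2 + q.2)
    rw [add_add_add_comm, show p.1 + p'.2 = _ from h, show q.1 + q'.2 = _ from h',
      add_add_add_comm]

instance : Neg (Diff N) where
  neg := Quotient.map (fun p => (p.2, p.1)) fun p q h => by
    change p.2 + q.1 = q.2 + p.1
    rw [add_comm, ← show p.1 + q.2 = _ from h, add_comm]

instance : Mul (Diff N) where
  mul := Quotient.map₂ (fun p q => (p.1 * q.1 + p.2 * q.2, p.1 * q.2 + p.2 * q.1))
    fun p p' h q q' h' => by
      apply (diffSetoid N).trans (b := (p.1 * q'.1 + p.2 * q'.2, p.1 * q'.2 + p.2 * q'.1))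
      · change p.1 * q.1 + p.2 * q.2 + (p.1 * q'.2 + p.2 * q'.1) =
          p.1 * q'.1 + p.2 * q'.2 + (p.1 * q.2 + p.2 * q.1)
        calc _ = p.1 * (q.1 + q'.2) + p.2 * (q'.1 + q.2) := by ring
          _ = p.1 * (q'.1 + q.2) + p.2 * (q.1 + q'.2) := by rw [show q.1 + q'.2 = _ from h']
          _ = _ := by ring
      · change p.1 * q'.1 + p.2 * q'.2 + (p'.1 * q'.2 + p'.2 * q'.1) =
          p'.1 * q'.1 + p'.2 * q'.2 + (p.1 * q'.2 + p.2 * q'.1)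
        calc _ = (p.1 + p'.2) * q'.1 + (p'.1 + p.2) * q'.2 := by ring
          _ = (p'.1 + p.2) * q'.1 + (p.1 + p'.2) * q'.2 := by rw [show p.1 + p'.2 = _ from h]
          _ = _ := by ring

theorem mk_add (a b c d : N) : mk a b + mk c d = mk (a + c) (b + d) := rfl

instance : Zero (Diff N) := ⟨mk 0 0⟩

instance : CommRing (Diff N) where
  one := mk 1 0
  add_assoc x y z := by
    induction x using ind; induction y using ind; induction z using ind
    simp only [mk_add, add_assoc]
  add_comm x y := by
    induction x using ind; induction y using ind
    simp only [mk_add, add_comm]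
  zero_add x := by
    induction x using ind
    exact mk_eq_mk.2 (by ring)
  add_zero x := by
    induction x using ind
    exact mk_eq_mk.2 (by ring)
  neg_add_cancel x := by
    induction x using ind
    exact mk_eq_mk.2 (by ring)
  mul_assoc x y z := by
    induction x using ind; induction y using ind; induction z using ind
    exact mk_eq_mk.2 (by ring)
  mul_comm x y := by
    induction x using ind; induction y using ind
    exact mk_eq_mk.2 (by ring)
  one_mul x := by
    induction x using ind
    exact mk_eq_mk.2 (by ring)
  mul_one x := by
    induction x using ind
    exact mk_eq_mk.2 (by ring)
  zero_mul x := by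
    induction x using ind
    exact mk_eq_mk.2 (by ring)
  mul_zero x := by
    induction x using ind
    exact mk_eq_mk.2 (by ring)
  left_distrib x y z := by
    induction x using ind; induction y using ind; induction z using ind
    exact mk_eq_mk.2 (by ring)
  right_distrib x y z := by
    induction x using ind; induction y using ind; induction z using ind
    exact mk_eq_mk.2 (by ring)
  nsmul := nsmulRec
  zsmul := zsmulRec

/-- The embedding of `N`. -/
def of : N →+* Diff N where
  toFun a := mk a 0
  map_zero' := rfl
  map_one' := rfl
  map_add' a b := mk_eq_mk.2 (by ring)
  map_mul' a b := mk_eq_mk.2 (by ring)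

theorem of_inj {a b : N} : of a = of b ↔ a = b :=
  mk_eq_mk.trans (by rw [add_zero, add_zero])

theorem eq_of_or (x : Diff N) : ∃ a, x = of a ∨ x = -of a := by
  induction x using ind with
  | h a b =>
    rcases le_total a b with h | h
    · obtain ⟨c, rfl⟩ := exists_add_of_le h
      exact ⟨c, .inr (mk_eq_mk.2 (by ring))⟩
    · obtain ⟨c, rfl⟩ := exists_add_of_le h
      exact ⟨c, .inl (mk_eq_mk.2 (by ring))⟩

instance : Nontrivial (Diff N) :=
  ⟨of 1, of 0, fun h => one_ne_zero (of_inj.1 h)⟩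

instance : NoZeroDivisors (Diff N) where
  eq_zero_or_eq_zero_of_mul_eq_zero {x y} h := by
    have key : ∀ {a b : N}, of a * of b = 0 → of a = 0 ∨ of b = 0 := fun {a b} h => by
      rw [← map_mul, ← map_zero of, of_inj] at h
      rw [← map_zero of, of_inj, of_inj]
      exact mul_eq_zero.1 h
    obtain ⟨a, rfl | rfl⟩ := eq_of_or x <;> obtain ⟨b, rfl | rfl⟩ := eq_of_or y <;>
      first
      | exact key h
      | (simp only [mul_neg, neg_mul, neg_neg, neg_eq_zero] at h ⊢; exact key h)

instance : IsDomain (Diff N) := NoZeroDivisors.to_isDomain _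

end Diff

variable (N) in
/-- The field of fractions of `N`. -/
def FracField : Type u := FractionRing (Diff N)

namespace FracField

noncomputable instance : Field (FracField N) := inferInstanceAs (Field (FractionRing (Diff N)))

/-- The embedding of `N` into its field of fractions. -/
noncomputable def of : N →+* FracField N :=
  (algebraMap (Diff N) (FractionRing (Diff N))).comp Diff.of

theorem of_inj {a b : N} : of a = of b ↔ a = b :=
  (IsFractionRing.injective (Diff N) (FractionRing (Diff N))).eq_iff.trans Diff.of_inj

theorem of_ne_zero {a : N} (h : a ≠ 0) : of a ≠ 0 := fun h' => h (of_inj.1 (h'.trans (map_zero of).symm))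

theorem exists_eq (x : FracField N) : ∃ a b : N, b ≠ 0 ∧ (x = of a / of b ∨ x = -(of a / of b)) := by
  obtain ⟨y, z, hz, h⟩ := IsFractionRing.div_surjective (A := Diff N) (K := FractionRing (Diff N)) x
  have hz := nonZeroDivisors.ne_zero hz
  obtain ⟨a, ha⟩ := Diff.eq_of_or y
  obtain ⟨b, hb⟩ := Diff.eq_of_or z
  refine ⟨a, b, ?_, ?_⟩
  · rintro rfl
    simp at hb
    exact hz hb
  · subst h
    rcases ha with rfl | rfl <;> rcases hb with rfl | rfl
    · exact .inl rfl
    · right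
      rw [map_neg, div_neg]
      rfl
    · right
      rw [map_neg, neg_div]
      rfl
    · left
      rw [map_neg, map_neg, neg_div_neg_eq]
      rfl

variable (N) in
/-- The nonnegative elements of the field of fractions. -/
def cone : AddGroupCone (FracField N) where
  carrier := {x | ∃ a b : N, b ≠ 0 ∧ x = of a / of b}
  zero_mem' := ⟨0, 1, one_ne_zero, by simp⟩
  add_mem' := by
    rintro _ _ ⟨a, b, hb, rfl⟩ ⟨c, d, hd, rfl⟩
    refine ⟨a * d + b * c, b * d, mul_ne_zero hb hd, ?_⟩
    rw [div_add_div _ _ (of_ne_zero hb) (of_ne_zero hd)]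
    simp
  eq_zero_of_mem_of_neg_mem' := by
    rintro _ ⟨a, b, hb, rfl⟩ ⟨c, d, hd, h⟩
    rw [← sub_eq_zero, neg_sub_left, neg_eq_zero, div_add_div _ _ (of_ne_zero hd) (of_ne_zero hb),
      div_eq_zero_iff, or_iff_left (mul_ne_zero (of_ne_zero hd) (of_ne_zero hb)), ← map_mul,
      ← map_mul, ← map_add, ← map_zero of, of_inj, add_eq_zero, mul_eq_zero, mul_eq_zero] at h
    rw [(h.2.resolve_left hd), map_zero, zero_div]

instance : HasMemOrNegMem (cone N) where
  mem_or_neg_mem x := by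
    obtain ⟨a, b, hb, rfl | rfl⟩ := exists_eq x
    · exact .inl ⟨a, b, hb, rfl⟩
    · exact .inr ⟨a, b, hb, neg_neg _⟩

open Classical in
noncomputable instance : LinearOrder (FracField N) :=
  LinearOrder.mkOfAddGroupCone (cone N)

theorem nonneg_iff {x : FracField N} : 0 ≤ x ↔ ∃ a b : N, b ≠ 0 ∧ x = of a / of b := by
  change x - 0 ∈ cone N ↔ _
  rw [sub_zero]
  rfl

instance : IsOrderedAddMonoid (FracField N) := IsOrderedAddMonoid.mkOfCone (cone N)

instance : IsStrictOrderedRing (FracField N) :=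
  haveI : ZeroLEOneClass (FracField N) := ⟨nonneg_iff.2 ⟨1, 1, one_ne_zero, by simp⟩⟩
  .of_mul_pos fun x y hx hy => by
    obtain ⟨a, b, hb, rfl⟩ := nonneg_iff.1 hx.le
    obtain ⟨c, d, hd, rfl⟩ := nonneg_iff.1 hy.le
    refine lt_of_le_of_ne (nonneg_iff.2 ⟨a * c, b * d, mul_ne_zero hb hd, ?_⟩)
      (mul_ne_zero hx.ne' hy.ne').symm
    rw [map_mul, map_mul, div_mul_div_comm]

theorem of_nonneg (a : N) : 0 ≤ of a := nonneg_iff.2 ⟨a, 1, one_ne_zero, by simp⟩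

theorem of_pos {a : N} (h : a ≠ 0) : 0 < of a := (of_nonneg a).lt_of_ne' (of_ne_zero h)

theorem of_le {a b : N} : of a ≤ of b ↔ a ≤ b := by
  have key : ∀ {a b : N}, a ≤ b → of a ≤ of b := fun {a b} h => by
    obtain ⟨c, rfl⟩ := exists_add_of_le h
    rw [map_add]
    exact le_add_of_nonneg_right (of_nonneg c)
  refine ⟨fun h => ?_, key⟩
  by_contra! h'
  exact h'.ne' (of_inj.1 (le_antisymm h (key h'.le)))

theorem of_lt {a b : N} : of a < of b ↔ a < b := lt_iff_lt_of_le_iff_le of_le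

end FracField

end OrderedField

end HigherOrderRM

/-! ### Real numbers of a model: estimates, definability of the order, dyadic rationals. -/

namespace HigherOrderRM.TypeStructure

section Reals

set_option linter.unusedSectionVars false
set_option linter.style.haveILetI false

variable {M : TypeStructure.{u}} [hM : Fact M.ModelsACA] {X : Type u} [Ctx M X]

open FracField (of of_le of_lt of_inj of_ne_zero of_nonneg of_pos)

/-! The values of fractions -/

/-- The rational number `1 / 2 ^ k` in the field of fractions of the numbers. -/
noncomputable def eps (k : M.El T0) : FracField (M.El T0) := (of (M.twoPow k))⁻¹

theorem eps_pos (k : M.El T0) : 0 < eps k := inv_pos.2 (of_pos (twoPow_pos k).ne')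

theorem eps_zero : eps (0 : M.El T0) = 1 := by rw [eps, twoPow_zero, map_one, inv_one]

theorem eps_add_one (k : M.El T0) : eps (k + 1) = eps k / 2 := by
  rw [eps, twoPow_add_one, map_mul, map_ofNat, mul_inv, eps, div_eq_inv_mul]

theorem eps_add (k m : M.El T0) : eps (k + m) = eps k * eps m := by
  rw [eps, twoPow_add, map_mul, mul_inv, eps, eps]

theorem eps_anti {k m : M.El T0} (h : k ≤ m) : eps m ≤ eps k :=
  inv_anti₀ (of_pos (twoPow_pos k).ne') (of_le.2 (twoPow_mono h))

theorem eps_strictAnti {k m : M.El T0} (h : k < m) : eps m < eps k :=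
  (eps_anti (add_one_le_iff'.2 h)).trans_lt (by rw [eps_add_one]; exact half_lt_self (eps_pos k))

theorem eps_le_eps {k m : M.El T0} : eps m ≤ eps k ↔ k ≤ m :=
  ⟨fun h => by by_contra! h'; exact (eps_strictAnti h').not_ge h, eps_anti⟩

theorem mul_eps_lt_one (k : M.El T0) : of k * eps k < 1 := by
  rw [eps, ← div_eq_mul_inv, div_lt_one (of_pos (twoPow_pos k).ne'), of_lt]
  exact lt_twoPow k

/-- The field is Archimedean relative to the numbers of the model: if `a ≥ 1`, then `a / b` exceeds
`2 ^ (-b)`, because `b < 2 ^ b`. -/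
theorem exists_eps_lt {x : FracField (M.El T0)} (h : 0 < x) : ∃ k : M.El T0, eps k < x := by
  obtain ⟨a, b, hb, rfl⟩ := FracField.nonneg_iff.1 h.le
  have ha : a ≠ 0 := by
    rintro rfl
    simp at h
  refine ⟨b, ?_⟩
  rw [lt_div_iff₀ (of_pos hb), mul_comm]
  refine (mul_eps_lt_one b).trans_le ?_
  rw [← map_one of, of_le, ← zero_add 1, add_one_le_iff']
  exact ha.pos

/-- The value of a fraction. -/
noncomputable def Fraction.val (p : Fraction M) : FracField (M.El T0) :=
  (of p.pos - of p.neg) / of p.den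

/-- The cross-multiplied inequality between numbers becomes one in an ordered field, where
subtraction and `linarith` are at hand. -/
theorem Fraction.le_iff {p q : Fraction M} (hp : p.den ≠ 0) (hq : q.den ≠ 0) :
    p.le q ↔ p.val ≤ q.val := by
  have h : p.le q ↔ p.pos * q.den + q.neg * p.den ≤ q.pos * p.den + p.neg * q.den := Iff.rfl
  rw [h, ← of_le, Fraction.val, Fraction.val, div_le_div_iff₀ (of_pos hp) (of_pos hq)]
  simp only [map_add, map_mul]
  constructor <;> intro h <;> linarith

theorem Fraction.val_add {p q : Fraction M} (hp : p.den ≠ 0) (hq : q.den ≠ 0) :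
    (p.add q).val = p.val + q.val := by
  have hp' := of_ne_zero hp
  have hq' := of_ne_zero hq
  simp only [Fraction.val, Fraction.add, add_eq, mul_eq, map_add, map_mul]
  field_simp
  ring

theorem Fraction.val_smul (n : M.El T0) (p : Fraction M) : (p.smul n).val = of n * p.val := by
  simp only [Fraction.val, Fraction.smul, mul_eq, map_mul]
  ring

theorem Fraction.val_ofNumber (n : M.El T0) : (Fraction.ofNumber n).val = of n := by
  simp [Fraction.val, Fraction.ofNumber, one_eq, zero_eq]

theorem Fraction.val_invTwoPow (n : M.El T0) : (Fraction.invTwoPow n).val = eps n := by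
  simp [Fraction.val, Fraction.invTwoPow, one_eq, zero_eq, eps]

/-- All entries of a sequence of fractions have nonzero denominators. -/
def RatSeq.IsProper (u : RatSeq M) : Prop := ∀ k, (u k).den ≠ 0

theorem Fraction.ofCode_pair (a b c : M.El T0) :
    Fraction.ofCode (pair (pair a b) c) = ⟨a, b, M.succ c⟩ := by
  have h : ∃ t : M.El T0 × M.El T0 × M.El T0,
    pair (pair a b) c = pair (pair t.1 t.2.1) t.2.2 := ⟨(a, b, c), rfl⟩
  rw [Fraction.ofCode, dif_pos h]
  obtain ⟨h1, h2⟩ := pair_inj h.choose_spec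
  obtain ⟨h3, h4⟩ := pair_inj h1
  rw [← h2, ← h3, ← h4]

theorem Fraction.ofCode_of_not {c : M.El T0} (h : ¬ ∃ x y z, c = pair (pair x y) z) :
    Fraction.ofCode c = Fraction.ofNumber M.zero := by
  rw [Fraction.ofCode, dif_neg]
  rintro ⟨t, ht⟩
  exact h ⟨_, _, _, ht⟩

namespace RatSeq

theorem isProper_seq (a : M.El T1) : (seq a).IsProper := fun k => by
  change (Fraction.ofCode (a k)).den ≠ 0
  by_cases h : ∃ x y z, a k = pair (pair x y) z
  · obtain ⟨x, y, z, h⟩ := h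
    rw [h, Fraction.ofCode_pair]
    exact rca.succ_ne_zero z
  · rw [Fraction.ofCode_of_not h]
    exact one_ne_zero'

theorem IsProper.add {u v : RatSeq M} (hu : u.IsProper) (hv : v.IsProper) : (u.add v).IsProper :=
  fun _ => mul_ne_zero (hu _) (hv _)

theorem IsProper.smul {u : RatSeq M} (n : M.El T0) (hu : u.IsProper) : (u.smul n).IsProper :=
  fun _ => hu _

theorem isProper_ofNumber (n : M.El T0) : (RatSeq.ofNumber n).IsProper := fun _ => one_ne_zero'

theorem isProper_invTwoPow (k : M.El T0) : (RatSeq.invTwoPow k).IsProper :=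
  fun _ => (twoPow_pos k).ne'

/-- The values of the entries of a sequence of fractions. -/
noncomputable def val (u : RatSeq M) (k : M.El T0) : FracField (M.El T0) := (u k).val

theorem le_iff {u v : RatSeq M} (hu : u.IsProper) (hv : v.IsProper) :
    u.le v ↔ ∀ k, u.val k ≤ v.val k + 2 * eps k := by
  have h1 : ∀ k : M.El T0, ((Fraction.invTwoPow k).add (Fraction.invTwoPow k)).den ≠ 0 :=
    fun k => mul_ne_zero (twoPow_pos k).ne' (twoPow_pos k).ne'
  have h2 : ∀ k, ((v k).add ((Fraction.invTwoPow k).add (Fraction.invTwoPow k))).den ≠ 0 :=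
    fun k => mul_ne_zero (hv k) (h1 k)
  refine forall_congr' fun k => ?_
  rw [Fraction.le_iff (hu k) (h2 k), Fraction.val_add (hv k) (h1 k),
    Fraction.val_add (twoPow_pos k).ne' (twoPow_pos k).ne', Fraction.val_invTwoPow, ← two_mul]
  rfl

theorem lt_iff {u v : RatSeq M} (hu : u.IsProper) (hv : v.IsProper) :
    u.lt v ↔ ∃ k, u.val k + 2 * eps k < v.val k := by
  rw [RatSeq.lt, le_iff hv hu]
  push Not
  rfl

theorem val_add {u v : RatSeq M} (hu : u.IsProper) (hv : v.IsProper) (k : M.El T0) :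
    (u.add v).val k = u.val (k + 1) + v.val (k + 1) := by
  rw [← succ_eq]
  exact Fraction.val_add (hu _) (hv _)

theorem val_smul (u : RatSeq M) (n k : M.El T0) :
    (u.smul n).val k = of n * u.val (k + n) := Fraction.val_smul _ _

theorem val_ofNumber (n k : M.El T0) : (RatSeq.ofNumber n).val k = of n :=
  Fraction.val_ofNumber _

theorem val_invTwoPow (n k : M.El T0) : (RatSeq.invTwoPow n).val k = eps n :=
  Fraction.val_invTwoPow _

end RatSeq

theorem isReal_iff (a : M.El T1) : IsReal a ↔ ∀ n m : M.El T0,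
    (seq a).val n ≤ (seq a).val (n + m) + eps n ∧
      (seq a).val (n + m) ≤ (seq a).val n + eps n := by
  have h := RatSeq.isProper_seq a
  refine forall₂_congr fun n m => and_congr ?_ ?_
  · rw [Fraction.le_iff (h _) (mul_ne_zero (h _) (twoPow_pos n).ne'),
      Fraction.val_add (h _) (twoPow_pos n).ne', Fraction.val_invTwoPow]
    rfl
  · rw [Fraction.le_iff (h _) (mul_ne_zero (h _) (twoPow_pos n).ne'),
      Fraction.val_add (h _) (twoPow_pos n).ne', Fraction.val_invTwoPow]
    rfl

theorem le_of_forall_eps {x y : FracField (M.El T0)} (h : ∀ k : M.El T0, x ≤ y + eps k) : x ≤ y := by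
  by_contra! h'
  obtain ⟨k, hk⟩ := exists_eps_lt (sub_pos.2 h')
  linarith [h k]

theorem eps_add_le_left (k m : M.El T0) : eps (k + m) ≤ eps k := eps_anti le_self_add

theorem eps_add_le_right (k m : M.El T0) : eps (k + m) ≤ eps m := eps_anti le_add_self

/-- A real number is at most the rational number `q` if its approximations are so up to their
error. -/
theorem IsReal.le_const_iff {a : M.El T1} (ha : IsReal a) {v : RatSeq M} (hv : v.IsProper)
    {q : FracField (M.El T0)} (hq : ∀ k, v.val k = q) :
    (seq a).le v ↔ ∀ k, (seq a).val k ≤ q + eps k := by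
  rw [RatSeq.le_iff (RatSeq.isProper_seq a) hv]
  constructor
  · intro h k
    -- At index `k + (m + 1)` the tolerance `2 * eps` of the order is at most `eps m`, which
    -- disappears as `m` varies; only the error `eps k` of passing back to index `k` remains.
    refine le_of_forall_eps fun m => ?_
    have h1 := ((isReal_iff a).1 ha k (m + 1)).1
    have h2 := h (k + (m + 1))
    have h3 := eps_add_le_right k (m + 1)
    rw [eps_add_one] at h3
    rw [hq] at h2
    linarith
  · intro h k
    rw [hq]
    linarith [h k, eps_pos k]

/-- The approximations of a real number that is at least the rational number `q`. -/
theorem IsReal.const_le_iff {a : M.El T1} (ha : IsReal a) {v : RatSeq M} (hv : v.IsProper)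
    {q : FracField (M.El T0)} (hq : ∀ k, v.val k = q) :
    v.le (seq a) ↔ ∀ k, q ≤ (seq a).val k + eps k := by
  rw [RatSeq.le_iff hv (RatSeq.isProper_seq a)]
  constructor
  · intro h k
    refine le_of_forall_eps fun m => ?_
    have h1 := ((isReal_iff a).1 ha k (m + 1)).2
    have h2 := h (k + (m + 1))
    have h3 := eps_add_le_right k (m + 1)
    rw [eps_add_one] at h3
    rw [hq] at h2
    linarith
  · intro h k
    rw [hq]
    linarith [h k, eps_pos k]

theorem RatSeq.const_le_const_iff {u v : RatSeq M} (hu : u.IsProper) (hv : v.IsProper)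
    {p q : FracField (M.El T0)} (hp : ∀ k, u.val k = p) (hq : ∀ k, v.val k = q) :
    u.le v ↔ p ≤ q := by
  rw [RatSeq.le_iff hu hv]
  simp_rw [hp, hq]
  refine ⟨fun h => le_of_forall_eps fun k => ?_, fun h k => by linarith [eps_pos k]⟩
  have := h (k + 1)
  rw [eps_add_one] at this
  linarith

theorem RatSeq.const_lt_const_iff {u v : RatSeq M} (hu : u.IsProper) (hv : v.IsProper)
    {p q : FracField (M.El T0)} (hp : ∀ k, u.val k = p) (hq : ∀ k, v.val k = q) :
    u.lt v ↔ p < q := by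
  rw [RatSeq.lt, const_le_const_iff hv hu hq hp, not_le]

theorem RatSeq.le_refl {u : RatSeq M} (hu : u.IsProper) : u.le u := by
  rw [RatSeq.le_iff hu hu]
  intro k
  linarith [eps_pos k]

/-- Since `l * 2 ^ (-l) < 1`, the bound on `c` gives `l * c ≤ 2 ^ (-(k + 1))`, which leaves half of
`eps k` as slack for the approximation errors. -/
theorem lt_add_of_le_add_smul {a b c : M.El T1} (hc : IsReal c) {l k : M.El T0}
    (h : (seq a).le ((seq b).add ((seq c).smul l)))
    (hl : (seq c).lt (RatSeq.invTwoPow (k + 1 + l))) :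
    (seq a).lt ((seq b).add (RatSeq.invTwoPow k)) := by
  have pa := RatSeq.isProper_seq a
  have pb := RatSeq.isProper_seq b
  have pc := RatSeq.isProper_seq c
  rw [RatSeq.lt_iff pa (pb.add (RatSeq.isProper_invTwoPow k))]
  rw [RatSeq.le_iff pa (pb.add (pc.smul l))] at h
  rw [RatSeq.lt_iff pc (RatSeq.isProper_invTwoPow _)] at hl
  obtain ⟨j, hj⟩ := hl
  rw [RatSeq.val_invTwoPow] at hj
  have h1 : ∀ m, (seq c).val m ≤ eps (k + 1 + l) + eps m := fun m => by
    have h2 := ((isReal_iff c).1 hc m j).1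
    have h3 := ((isReal_iff c).1 hc j m).2
    rw [add_comm j m] at h3
    linarith [eps_pos j]
  -- At index `i` the errors add up to `9 / 2 * eps i`; they must stay below the slack `eps k / 2`,
  -- and `eps i = eps k / 16` is small enough.
  refine ⟨k + 1 + 1 + 1 + 1, ?_⟩
  set i := k + 1 + 1 + 1 + 1
  have h2 := h i
  rw [RatSeq.val_add pb (pc.smul l), RatSeq.val_smul] at h2
  rw [RatSeq.val_add pb (RatSeq.isProper_invTwoPow k), RatSeq.val_invTwoPow]
  have h3 := mul_le_mul_of_nonneg_left (h1 (i + 1 + l)) (of_nonneg l)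
  have h4 : of l * eps (k + 1 + l) ≤ eps (k + 1) := by
    rw [eps_add, mul_left_comm]
    exact mul_le_of_le_one_right (eps_pos _).le (mul_eps_lt_one l).le
  have h5 : of l * eps (i + 1 + l) ≤ eps (i + 1) := by
    rw [eps_add, mul_left_comm]
    exact mul_le_of_le_one_right (eps_pos _).le (mul_eps_lt_one l).le
  have h6 : eps i = eps k / 2 / 2 / 2 / 2 := by simp only [i, eps_add_one]
  rw [mul_add] at h3
  rw [eps_add_one] at h4 h5
  linarith [eps_pos k]

theorem IsLipschitz.isContinuous {e : M.El (T1 ⇒ T1 ⇒ T0)} {d : M.El (T1 ⇒ T1 ⇒ T1)}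
    (hd : IsMetric e d) {f : M.El (T1 ⇒ T1)} (hf : IsLipschitz d f) : IsContinuous d f := by
  obtain ⟨c, hc⟩ := hf
  refine fun x k => ⟨k + 1 + c, fun y hy => ?_⟩
  exact ⟨lt_add_of_le_add_smul (hd.isReal x y) (hc x y).1 hy,
    lt_add_of_le_add_smul (hd.isReal x y) (hc x y).2 hy⟩

/-! Definability of comparisons of real numbers -/

/-- Fractions that depend definably on parameters. -/
class InternalFraction (F : X → Fraction M) : Prop where
  pos : Internal (fun x => (F x).pos)
  neg : Internal (fun x => (F x).neg)
  den : Internal (fun x => (F x).den)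

attribute [instance] InternalFraction.pos InternalFraction.neg InternalFraction.den

/-- Sequences of fractions that depend definably on parameters. -/
class InternalRatSeq (F : X → RatSeq M) : Prop where
  out : InternalFraction (fun p : X × M.El T0 => F p.1 p.2)

instance InternalFraction.add (F G : X → Fraction M) [InternalFraction F] [InternalFraction G] :
    InternalFraction (fun x => (F x).add (G x)) := by
  constructor <;> simp only [Fraction.add] <;> infer_instance

instance InternalFraction.ofNumber (N : X → M.El T0) [Internal N] :
    InternalFraction (fun x => Fraction.ofNumber (N x)) := by
  constructor <;> simp only [Fraction.ofNumber] <;> infer_instance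

instance InternalFraction.invTwoPow (N : X → M.El T0) [Internal N] :
    InternalFraction (fun x => Fraction.invTwoPow (N x)) := by
  constructor <;> simp only [Fraction.invTwoPow] <;> infer_instance

/-- The components are defined by choice outside the model; as pairing is injective they agree with
the definable projections `fst` and `snd`. -/
theorem InternalFraction.ofCode : InternalFraction (fun c : M.El T0 => Fraction.ofCode c) := by
  classical
  have h : ∀ c : M.El T0, Fraction.ofCode c =
      ⟨if ∃ x y z, c = pair (pair x y) z then fst (fst c) else M.zero,
        if ∃ x y z, c = pair (pair x y) z then snd (fst c) else M.zero,
        if ∃ x y z, c = pair (pair x y) z then M.succ (snd c) else M.one⟩ := fun c => by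
    split_ifs with hc
    · obtain ⟨x, y, z, rfl⟩ := hc
      simp only [Fraction.ofCode_pair, fst_pair, snd_pair]
    · exact Fraction.ofCode_of_not hc
  simp_rw [h]
  have h1 : Dec (fun c : M.El T0 => ∃ x y z, c = pair (pair x y) z) := inferInstance
  constructor
  · exact Internal.ite _ (fun c => TypeStructure.fst (TypeStructure.fst c)) _
  · exact Internal.ite _ (fun c => TypeStructure.snd (TypeStructure.fst c)) _
  · exact Internal.ite _ (fun c => M.succ (TypeStructure.snd c)) _

instance InternalRatSeq.seq (F : X → M.El T1) [Internal F] :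
    InternalRatSeq (fun x => seq (F x)) := by
  have h := InternalFraction.ofCode (M := M)
  have h1 := ‹Internal F›.weaken (σ := T0)
  exact ⟨⟨Internal.comp (hF := h.pos) _ _, Internal.comp (hF := h.neg) _ _,
    Internal.comp (hF := h.den) _ _⟩⟩

theorem InternalRatSeq.of_const (F : X → Fraction M) [h : InternalFraction F] :
    InternalRatSeq (fun x _ => F x) :=
  ⟨⟨h.pos.weaken, h.neg.weaken, h.den.weaken⟩⟩

instance InternalRatSeq.ofNumber (N : X → M.El T0) [Internal N] :
    InternalRatSeq (fun x => RatSeq.ofNumber (N x)) :=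
  InternalRatSeq.of_const fun x => Fraction.ofNumber (N x)

instance InternalRatSeq.invTwoPow (N : X → M.El T0) [Internal N] :
    InternalRatSeq (fun x => RatSeq.invTwoPow (N x)) :=
  InternalRatSeq.of_const fun x => Fraction.invTwoPow (N x)

instance Dec.fraction_le (F G : X → Fraction M) [InternalFraction F] [InternalFraction G] :
    Dec (fun x => (F x).le (G x)) := by
  simp only [Fraction.le, le_eq, add_eq, mul_eq]
  infer_instance

/-- The order of the reals is one universal number quantifier over a decidable relation of
fractions. -/
instance Dec.real_le (F G : X → RatSeq M) [hF : InternalRatSeq F] [hG : InternalRatSeq G] :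
    Dec (fun x => (F x).le (G x)) := by
  have h1 := hF.out
  have h2 := hG.out
  unfold RatSeq.le
  infer_instance

instance Dec.real_lt (F G : X → RatSeq M) [InternalRatSeq F] [InternalRatSeq G] :
    Dec (fun x => (F x).lt (G x)) := by
  unfold RatSeq.lt
  infer_instance

/-! Dyadic rational numbers -/

/-- The code of the real number `b / 2 ^ n`. -/
noncomputable def dyadicCode (b n : M.El T0) : M.El T0 :=
  -- Codes store the denominator minus one, hence the search for the predecessor of `2 ^ n`.
  pair (pair b 0) (pick fun c => M.succ c = M.twoPow n)

instance Internal.dyadicCode (F G : X → M.El T0) [Internal F] [Internal G] :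
    Internal (fun x => dyadicCode (F x) (G x)) := by
  have : Internal (fun p : M.El T0 × M.El T0 => TypeStructure.dyadicCode p.1 p.2) := by
    unfold TypeStructure.dyadicCode
    infer_instance
  exact Internal.comp₂ TypeStructure.dyadicCode F G

theorem val_dyadicCode (b n : M.El T0) :
    (Fraction.ofCode (dyadicCode b n)).val = of b * eps n := by
  have h := pick_spec (A := fun c => M.succ c = M.twoPow n) inferInstance (by
    rcases eq_zero_or_eq_add_one (M.twoPow n) with h | ⟨m, h⟩
    · exact ((twoPow_pos n).ne' h).elim
    · exact ⟨m, by rw [h, succ_eq]⟩)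
  rw [dyadicCode, Fraction.ofCode_pair, h]
  simp [Fraction.val, eps, div_eq_mul_inv]

/-- The real number `b / 2 ^ n`. -/
noncomputable def dyadic (b n : M.El T0) : M.El T1 := lam fun _ => dyadicCode b n

instance Internal.dyadic (F G : X → M.El T0) [Internal F] [Internal G] :
    Internal (fun x => dyadic (F x) (G x)) := by
  have : Internal (fun p : M.El T0 × M.El T0 => TypeStructure.dyadic p.1 p.2) := by
    unfold TypeStructure.dyadic
    infer_instance
  exact Internal.comp₂ TypeStructure.dyadic F G

theorem val_dyadic (b n k : M.El T0) : (seq (dyadic b n)).val k = of b * eps n := by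
  rw [RatSeq.val, seq, dyadic, lam_app, val_dyadicCode]

theorem isReal_dyadic (b n : M.El T0) : IsReal (dyadic b n) := by
  rw [isReal_iff]
  intro k m
  rw [val_dyadic, val_dyadic]
  constructor <;> linarith [eps_pos k]

end Reals

end HigherOrderRM.TypeStructure

/-! ### Suprema from the projection principle. -/

namespace HigherOrderRM.TypeStructure

section Suprema

set_option linter.unusedSectionVars false
set_option linter.style.haveILetI false

variable {M : TypeStructure.{u}} [hM : Fact M.ModelsACA] {X : Type u} [Ctx M X]

open FracField (of of_le of_lt of_inj of_ne_zero of_nonneg of_pos)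

/-- The projection principle for definable predicates. -/
theorem Boot.dec_exists (hB : M.Boot) (A : M.El T1 → M.El T0 → Prop)
    (hA : Dec (fun p : M.El T1 × M.El T0 => A p.1 p.2)) : Dec (fun n => ∃ f, A f n) := by
  obtain ⟨Y, hY⟩ : ∃ Y : M.El (T1 ⇒ T0 ⇒ T0), ∀ p : M.El T1 × M.El T0,
    Y p.1 p.2 = ind M (A p.1 p.2) := hA.out.out
  obtain ⟨U, -, hU⟩ := hB Y
  have : Dec (fun n => U n = M.one) := inferInstance
  refine this.congr fun n => (hU n).trans ?_
  refine exists_congr fun f => ?_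
  rw [hY (f, n), ind_eq_zero]

/-- The composition of a definable predicate of three variables with definable functions. -/
theorem Dec.comp₃ {ρ σ τ : Ty} (A : M.El ρ → M.El σ → M.El τ → Prop)
    (hA : Dec (fun p : (M.El ρ × M.El σ) × M.El τ => A p.1.1 p.1.2 p.2)) (F : X → M.El ρ)
    (G : X → M.El σ) (H : X → M.El τ) [Internal F] [Internal G] [Internal H] :
    Dec (fun x => A (F x) (G x) (H x)) :=
  have := hA.out
  ⟨Internal.comp₃ (fun a b c => ind M (A a b c)) F G H⟩

theorem eps_mul_twoPow (k m : M.El T0) : eps (k + m) * of (M.twoPow m) = eps k := by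
  rw [eps_add, mul_assoc, eps, eps, inv_mul_cancel₀ (of_ne_zero (twoPow_pos m).ne'), mul_one]

/-- The value of `f` at some point of `A` is greater than `j / 2 ^ k`, or `j = 0`. -/
def Exceeded (A : M.El T1 → Prop) (f : M.El (T1 ⇒ T1)) (j k : M.El T0) : Prop :=
  -- The clause `j = 0` starts the search for the last exceeded `j`; without it nothing would be
  -- exceeded when `f` vanishes on `A`.
  j = 0 ∨ ∃ z, A z ∧ (seq (dyadic j k)).lt (seq (f z))

variable {A : M.El T1 → Prop} {f : M.El (T1 ⇒ T1)}

theorem lt_seq_iff {z : M.El T1} (hf : IsReal (f z)) {j k : M.El T0} :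
    (seq (dyadic j k)).lt (seq (f z)) ↔ ∃ i, of j * eps k + eps i < (seq (f z)).val i := by
  rw [RatSeq.lt, hf.le_const_iff (RatSeq.isProper_seq _) (val_dyadic j k)]
  push Not
  rfl

theorem Exceeded.anti (hf : ∀ z, IsReal (f z)) {j k j' k' : M.El T0} (h : Exceeded A f j k)
    (hj : of j' * eps k' ≤ of j * eps k) : Exceeded A f j' k' := by
  rcases h with rfl | ⟨z, hz, h⟩
  · left
    rw [map_zero, zero_mul] at hj
    have : of j' = 0 := by
      have h1 := mul_nonneg (of_nonneg j') (eps_pos k').le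
      exact (mul_eq_zero.1 (le_antisymm hj h1)).resolve_right (eps_pos k').ne'
    exact of_inj.1 (this.trans (map_zero of).symm)
  · refine .inr ⟨z, hz, ?_⟩
    rw [lt_seq_iff (hf z)] at h ⊢
    exact h.imp fun i hi => by linarith

theorem not_exceeded (hf : ∀ z, IsReal (f z)) {j k : M.El T0} (h : ¬ Exceeded A f (j + 1) k)
    {z : M.El T1} (hz : A z) (i : M.El T0) :
    (seq (f z)).val i ≤ (of j + 1) * eps k + eps i := by
  by_contra! h'
  refine h (.inr ⟨z, hz, (lt_seq_iff (hf z)).2 ⟨i, ?_⟩⟩)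
  rwa [map_add, map_one]

/-- As `f ≤ 1`, the dyadic `2 ^ k / 2 ^ k` is not exceeded, so there is a last exceeded `j` before
the first failure. -/
theorem exists_maximal_exceeded (hf : ∀ z, IsReal (f z))
    (hf1 : ∀ z, (seq (f z)).le (RatSeq.ofNumber M.one)) (k : M.El T0)
    (hd : Dec fun j => Exceeded A f j k) :
    ∃ j, Exceeded A f j k ∧ ¬ Exceeded A f (j + 1) k := by
  have h : ¬ Exceeded A f (M.twoPow k) k := by
    rintro (h | ⟨z, -, h⟩)
    · exact (twoPow_pos k).ne' h
    · obtain ⟨i, hi⟩ := (lt_seq_iff (hf z)).1 h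
      have h1 := ((hf z).le_const_iff (RatSeq.isProper_ofNumber _)
        (RatSeq.val_ofNumber _)).1 (hf1 z) i
      have h2 := eps_mul_twoPow 0 k
      rw [zero_add, eps_zero] at h2
      rw [one_eq, map_one] at h1
      linarith
  obtain ⟨j, -, h⟩ := hd.exists_step (.inl rfl) h
  exact ⟨j, h⟩

/-- The supremum is the real number approximated by the maximal exceeded dyadic rationals. -/
theorem isSup_of_maximal (hf : ∀ z, IsReal (f z))
    (hf0 : ∀ z, (RatSeq.ofNumber M.zero).le (seq (f z))) (hA : ∃ z, A z)
    (J : M.El T0 → M.El T0) (hJ : ∀ k, Exceeded A f (J k) k ∧ ¬ Exceeded A f (J k + 1) k)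
    {a : M.El T1} (ha : ∀ k, (seq a).val k = of (J k) * eps k) : IsSup A f a := by
  -- Every lower estimate of the supremum is below every upper estimate, whatever the two
  -- precisions.
  have key : ∀ j k k', Exceeded A f j k → of j * eps k ≤ (of (J k') + 1) * eps k' := by
    intro j k k' h
    by_contra! h'
    refine (hJ k').2 (h.anti hf ?_)
    rw [map_add, map_one]
    exact h'.le
  have hreal : IsReal a := by
    rw [isReal_iff]
    intro n m
    rw [ha, ha]
    constructor
    · have h1 : of (J n) * eps n = of (J n * M.twoPow m) * eps (n + m) := by
        rw [map_mul, mul_assoc, mul_comm (of (M.twoPow m)), eps_mul_twoPow]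
      have h2 : Exceeded A f (J n * M.twoPow m) (n + m) := (hJ n).1.anti hf h1.ge
      have h3 : J n * M.twoPow m ≤ J (n + m) := by
        by_contra! h
        refine (hJ (n + m)).2 (h2.anti hf ?_)
        exact mul_le_mul_of_nonneg_right (of_le.2 (add_one_le_iff'.2 h)) (eps_pos _).le
      rw [h1]
      have := mul_le_mul_of_nonneg_right (of_le.2 h3) (eps_pos (n + m)).le
      linarith [eps_pos n]
    · have := key _ _ n (hJ (n + m)).1
      linarith
  refine ⟨hreal, fun z hz => ?_, fun b hb h => ?_⟩
  · rw [RatSeq.le_iff (RatSeq.isProper_seq _) (RatSeq.isProper_seq _)]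
    intro k
    have := not_exceeded hf (hJ k).2 hz k
    rw [ha]
    linarith
  · rw [RatSeq.le_iff (RatSeq.isProper_seq _) (RatSeq.isProper_seq _)]
    intro k
    have hfb : ∀ z, A z → ∀ i, (seq (f z)).val i ≤ (seq b).val i + 2 * eps i := fun z hz =>
      (RatSeq.le_iff (RatSeq.isProper_seq _) (RatSeq.isProper_seq _)).1 (h z hz)
    have hb' : ∀ m, (seq b).val (k + m) ≤ (seq b).val k + eps k := fun m =>
      ((isReal_iff b).1 hb k m).2
    rw [ha]
    rcases (hJ k).1 with h0 | ⟨z, hz, hlt⟩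
    -- For `J k = 0` nothing is known to be exceeded; the bound `0 ≤ b` comes from any point of `A`
    -- together with `f ≥ 0`.
    · obtain ⟨z, hz⟩ := hA
      have h1 := ((hf z).const_le_iff (RatSeq.isProper_ofNumber _)
        (RatSeq.val_ofNumber _)).1 (hf0 z) (k + 1 + 1)
      have h2 := hfb z hz (k + 1 + 1)
      have h3 := hb' (1 + 1)
      rw [← add_assoc] at h3
      rw [zero_eq, map_zero] at h1
      rw [eps_add_one, eps_add_one] at h1 h2
      rw [h0, map_zero, zero_mul]
      linarith [eps_pos k]
    · obtain ⟨i, hi⟩ := (lt_seq_iff (hf z)).1 hlt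
      have h1 := ((isReal_iff _).1 (hf z) i (k + 1)).1
      have h2 := hfb z hz (i + (k + 1))
      have h3 := hb' (i + 1)
      rw [show k + (i + 1) = i + (k + 1) by ring] at h3
      have h4 := eps_add_le_right i (k + 1)
      rw [eps_add_one] at h4
      linarith

/-- The projection principle yields the suprema of a sequence of functions on a sequence of
sets. -/
theorem Boot.exists_sup (hB : M.Boot) (A : M.El T0 → M.El T1 → Prop)
    (hA : Dec (fun p : M.El T0 × M.El T1 => A p.1 p.2)) (hA' : ∀ n, ∃ z, A n z)
    (f : M.El (T0 ⇒ T1 ⇒ T1)) (hf : ∀ n z, IsReal (f n z))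
    (hf0 : ∀ n z, (RatSeq.ofNumber M.zero).le (seq (f n z)))
    (hf1 : ∀ n z, (seq (f n z)).le (RatSeq.ofNumber M.one)) :
    ∃ y : M.El (T0 ⇒ T1), ∀ n, IsSup (A n) (f n) (y n) := by
  obtain ⟨a, ha⟩ : ∃ a : M.El (T0 ⇒ T1 ⇒ T0), ∀ p : M.El T0 × M.El T1,
    a p.1 p.2 = ind M (A p.1 p.2) := hA.out.out
  have ha' : ∀ n z, A n z ↔ a n z = M.zero := fun n z => by rw [ha (n, z), ind_eq_zero]
  -- The projection principle allows a single number parameter, so `n`, `j` and `k` are coded into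
  -- `c`.
  have h1 : Dec fun c : M.El T0 => ∃ z, a (fst c) z = M.zero ∧
      (seq (dyadic (fst (snd c)) (snd (snd c)))).lt (seq (f (fst c) z)) :=
    hB.dec_exists (fun z c => a (fst c) z = M.zero ∧
      (seq (dyadic (fst (snd c)) (snd (snd c)))).lt (seq (f (fst c) z))) inferInstance
  have h2 : Dec fun p : (M.El T0 × M.El T0) × M.El T0 => Exceeded (A p.1.1) (f p.1.1) p.1.2 p.2 := by
    have h3 : Dec fun p : (M.El T0 × M.El T0) × M.El T0 => ∃ z, a p.1.1 z = M.zero ∧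
        (seq (dyadic p.1.2 p.2)).lt (seq (f p.1.1 z)) := by
      have := h1.out
      have := Internal.comp (fun c : M.El T0 => ind M (∃ z, a (fst c) z = M.zero ∧
        (seq (dyadic (fst (snd c)) (snd (snd c)))).lt (seq (f (fst c) z))))
        fun p : (M.El T0 × M.El T0) × M.El T0 => pair p.1.1 (pair p.1.2 p.2)
      simp only [fst_pair, snd_pair] at this
      exact ⟨this⟩
    unfold Exceeded
    simp_rw [ha']
    infer_instance
  have h4 : Dec fun p : (M.El T0 × M.El T0) × M.El T0 =>
      Exceeded (A p.1.1) (f p.1.1) p.2 p.1.2 ∧ ¬ Exceeded (A p.1.1) (f p.1.1) (p.2 + 1) p.1.2 := by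
    have := Dec.comp₃ (fun n j k => Exceeded (A n) (f n) j k) h2
      (fun p : (M.El T0 × M.El T0) × M.El T0 => p.1.1) (fun p => p.2) (fun p => p.1.2)
    have := Dec.comp₃ (fun n j k => Exceeded (A n) (f n) j k) h2
      (fun p : (M.El T0 × M.El T0) × M.El T0 => p.1.1) (fun p => p.2 + 1) (fun p => p.1.2)
    infer_instance
  let J := fun n k => pick fun j => Exceeded (A n) (f n) j k ∧ ¬ Exceeded (A n) (f n) (j + 1) k
  have hJ : ∀ n k, Exceeded (A n) (f n) (J n k) k ∧ ¬ Exceeded (A n) (f n) (J n k + 1) k := by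
    intro n k
    refine pick_spec (Dec.section (fun (p : M.El T0 × M.El T0) j => Exceeded (A p.1) (f p.1) j p.2 ∧
      ¬ Exceeded (A p.1) (f p.1) (j + 1) p.2) (n, k)) ?_
    refine exists_maximal_exceeded (hf n) (hf1 n) k ?_
    have := Dec.comp₃ (fun n j k => Exceeded (A n) (f n) j k) h2
      (fun p : (M.El T0 × M.El T0) × M.El T0 => p.1.1) (fun p => p.2) (fun p => p.1.2)
    exact Dec.section (fun (p : M.El T0 × M.El T0) j => Exceeded (A p.1) (f p.1) j p.2) (n, k)
  have h5 : Internal fun p : M.El T0 × M.El T0 => J p.1 p.2 :=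
    Internal.pick fun (p : M.El T0 × M.El T0) j => Exceeded (A p.1) (f p.1) j p.2 ∧
      ¬ Exceeded (A p.1) (f p.1) (j + 1) p.2
  refine ⟨lam fun n => lam fun k => dyadicCode (J n k) k, fun n => ?_⟩
  refine isSup_of_maximal (hf n) (hf0 n) (hA' n) (J n) (hJ n) fun k => ?_
  have h6 : Internal fun k => dyadicCode (J n k) k :=
    Internal.section (fun n k => dyadicCode (J n k) k) n
  rw [RatSeq.val, seq, lam_app, lam_app, val_dyadicCode]

theorem Boot.supremumPrinciple (hB : M.Boot) (c : Compactness) : M.SupremumPrinciple c := by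
  intro e d hd _ f hf _ x
  have hx : ∀ n, InClosedBall d x n x := fun n => by
    have h := ((hd.eq_zero_iff x x).2 (hd.equiv.refl x)).1
    rw [(hd.isReal x x).le_const_iff (RatSeq.isProper_ofNumber _) (RatSeq.val_ofNumber _)] at h
    refine ((hd.isReal x x).le_const_iff (RatSeq.isProper_invTwoPow _)
      (RatSeq.val_invTwoPow n)).2 fun k => ?_
    have := h k
    rw [zero_eq, map_zero] at this
    linarith [eps_pos n]
  obtain ⟨y, hy⟩ := hB.exists_sup (InClosedBall d x) (by unfold InClosedBall; infer_instance)
    (fun n => ⟨x, hx n⟩) (M.K _ _ f) (fun n z => by rw [rca.K_eq]; exact hf.1.1 z)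
    (fun n z => by rw [rca.K_eq]; exact (hf.2 z).1) (fun n z => by rw [rca.K_eq]; exact (hf.2 z).2)
  exact ⟨y, fun n => by have := hy n; rwa [rca.K_eq] at this⟩

theorem Boot.sequentialSupremumPrinciple (hB : M.Boot) (c : Compactness) :
    M.SequentialSupremumPrinciple c := by
  intro e d _ _ f hf
  exact hB.exists_sup (fun _ _ => True) inferInstance (fun _ => ⟨M.K _ _ M.zero, trivial⟩) f
    (fun n => (hf n).1.1.1) (fun n z => ((hf n).1.2 z).1) (fun n z => ((hf n).1.2 z).2)

theorem SupremumPrinciple.lipschitz {c : Compactness} (h : M.SupremumPrinciple c) :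
    M.LipschitzSupremumPrinciple c :=
  fun e d hd hc f hf hl => h e d hd hc f hf (hl.isContinuous hd)

end Suprema

end HigherOrderRM.TypeStructure

/-! ### Finite sets under `Σ`-induction, and the compact spaces built from index functions. -/

namespace HigherOrderRM.TypeStructure

section Spaces

set_option linter.unusedSectionVars false
set_option linter.style.haveILetI false

variable {M : TypeStructure.{u}} [hM : Fact M.ModelsACA] {X : Type u} [Ctx M X]

open FracField (of of_le of_lt of_inj of_ne_zero of_nonneg of_pos)

/-! Consequences of `Σ`-induction -/

theorem SigmaInd.induction (hI : M.SigmaInd) (A : M.El T1 → M.El T0 → Prop)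
    (hA : Dec (fun p : M.El T1 × M.El T0 => A p.1 p.2)) (h0 : ∃ f, A f 0)
    (hs : ∀ n, (∃ f, A f n) → ∃ f, A f (n + 1)) (n : M.El T0) : ∃ f, A f n := by
  obtain ⟨Y, hY⟩ : ∃ Y : M.El (T1 ⇒ T0 ⇒ T0), ∀ p : M.El T1 × M.El T0,
    Y p.1 p.2 = ind M (A p.1 p.2) := hA.out.out
  have h : ∀ n, (∃ f, A f n) ↔ ∃ f, Y f n = M.zero := fun n =>
    exists_congr fun f => by rw [hY (f, n), ind_eq_zero]
  simp_rw [h] at h0 hs ⊢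
  exact hI Y h0 (fun n hn => by rw [succ_eq]; exact hs n hn) n

open Classical in
/-- The pigeonhole principle inside a model. -/
theorem SigmaInd.pigeonhole (hI : M.SigmaInd) (n : M.El T0) (h : M.El T1)
    (hh : ∀ i, i ≤ n → h i < n) : ∃ i j, i ≤ n ∧ j ≤ n ∧ i ≠ j ∧ h i = h j := by
  by_contra! H
  -- Stage `i` carries an injection of `{0, …, m}` into the numbers below `m`, where `m = n - i`. A
  -- new function arises at each stage, hence an induction with a function quantifier; at `m = 0` no
  -- value is left.
  have := hI.induction (fun f i => ∀ m, m + i = n → (∀ j, j ≤ m → f j < m) ∧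
    ∀ j k, j ≤ m → k ≤ m → f j = f k → j = k) inferInstance ⟨h, ?_⟩ ?_ n
  · obtain ⟨f, hf⟩ := this
    exact not_lt_zero ((hf 0 (zero_add n)).1 0 le_rfl)
  · rintro m rfl
    rw [add_zero] at hh H
    refine ⟨hh, fun j k hj hk hjk => ?_⟩
    by_contra hne
    exact H j k hj hk hne hjk
  · rintro i ⟨f, hf⟩
    by_cases hm : ∃ m, m + (i + 1) = n
    · obtain ⟨m, rfl⟩ := hm
      obtain ⟨h1, h2⟩ := hf (m + 1) (by ring)
      -- The argument sent to the forbidden value `m`, if any, is redirected to the value freed by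
      -- dropping the argument `m + 1`.
      refine ⟨lam fun j => if f j = m then f (m + 1) else f j, fun m' hm' => ?_⟩
      obtain rfl := add_right_cancel hm'
      have hlt : ∀ j, j ≤ m' → j < m' + 1 := fun j hj => lt_add_one_iff'.2 hj
      have h3 : ∀ j, j ≤ m' → f j = m' → f (m' + 1) ≠ m' := fun j hj hjm h' =>
        (hlt j hj).ne (h2 j (m' + 1) (hlt j hj).le le_rfl (hjm.trans h'.symm))
      refine ⟨fun j hj => ?_, fun j k hj hk => ?_⟩
      · rw [lam_app]
        split_ifs with h
        · exact lt_of_le_of_ne (lt_add_one_iff'.1 (h1 _ le_rfl)) (h3 j hj h)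
        · exact lt_of_le_of_ne (lt_add_one_iff'.1 (h1 _ (hlt j hj).le)) h
      · have h4 := h2 j k (hlt j hj).le (hlt k hk).le
        rw [lam_app, lam_app]
        split_ifs with h h' h'
        · exact fun _ => h4 (h.trans h'.symm)
        · exact fun hjk => absurd (h2 _ _ le_rfl (hlt k hk).le hjk) (hlt k hk).ne'
        · exact fun hjk => absurd (h2 _ _ (hlt j hj).le le_rfl hjk) (hlt j hj).ne
        · exact h4
    · exact ⟨f, fun m hm' => (hm ⟨m, hm'⟩).elim⟩

/-- The rows of a function, as coded by pairing. -/
noncomputable def row (f : M.El T1) (i : M.El T0) : M.El T1 := lam fun j => f (pair i j)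

instance Internal.row (F : X → M.El T1) (G : X → M.El T0) [Internal F] [Internal G] :
    Internal (fun x => row (F x) (G x)) := by
  have : Internal (fun p : M.El T1 × M.El T0 => TypeStructure.row p.1 p.2) := by
    unfold TypeStructure.row
    infer_instance
  exact Internal.comp₂ TypeStructure.row F G

instance Internal.row_const (f : M.El T1) : Internal (fun i => TypeStructure.row f i) :=
  Internal.row (fun _ => f) fun i => i

open Classical in
/-- The values of `v` below `k` are attained on a finite sequence of points. -/
theorem SigmaInd.exists_enumeration (hI : M.SigmaInd) (v : M.El (T1 ⇒ T0)) (k : M.El T0) :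
    ∃ (l : M.El T0) (w : M.El (T0 ⇒ T1)), ∀ x, v x < k → ∃ i, i < l ∧ v x = v (w i) := by
  by_contra! H
  -- If no list is complete, lists with distinct values below `k` can be extended to every length;
  -- length `k + 1` contradicts the pigeonhole principle. The lists are coded as rows of one
  -- function, so that `Σ`-induction applies.
  have := hI.induction (fun f l => (∀ i, i < l → v (row f i) < k) ∧
    ∀ i j, i < l → j < l → v (row f i) = v (row f j) → i = j) inferInstance
    ⟨M.K _ _ M.zero, fun i hi => absurd hi not_lt_zero, fun i j hi => absurd hi not_lt_zero⟩ ?_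
    (k + 1)
  · obtain ⟨f, h1, h2⟩ := this
    obtain ⟨i, j, hi, hj, hne, h⟩ := hI.pigeonhole k (lam fun i => v (row f i)) fun i hi => by
      rw [lam_app]
      exact h1 i (lt_add_one_iff'.2 hi)
    rw [lam_app, lam_app] at h
    exact hne (h2 i j (lt_add_one_iff'.2 hi) (lt_add_one_iff'.2 hj) h)
  · rintro l ⟨f, h1, h2⟩
    obtain ⟨x, hx, hx'⟩ := H l (lam fun i => row f i)
    have hx' : ∀ i, i < l → v x ≠ v (row f i) := fun i hi => by
      have := hx' i hi
      rwa [lam_app] at this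
    -- Rows below `l` are kept, and row `l` becomes the new point `x`, as do all later rows.
    refine ⟨lam fun c => if fst c < l then f c else x (snd c), ?_⟩
    set f' := lam fun c => if fst c < l then f c else x (snd c) with hf'
    have h3 : ∀ i, i < l → row f' i = row f i := fun i hi => rca.ext _ _ fun j => by
      rw [row, row, lam_app, hf', lam_app, if_pos (by rwa [fst_pair]), lam_app]
    have h4 : row f' l = x := rca.ext _ _ fun j => by
      rw [row, lam_app, hf', lam_app, if_neg (by rw [fst_pair]; exact lt_irrefl l), snd_pair]
    have h5 : ∀ i, i < l + 1 → i < l ∨ i = l := fun i hi => (lt_add_one_iff'.1 hi).lt_or_eq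
    refine ⟨fun i hi => ?_, fun i j hi hj => ?_⟩
    · rcases h5 i hi with h | rfl
      · rw [h3 i h]
        exact h1 i h
      · rwa [h4]
    · rcases h5 i hi with h | rfl <;> rcases h5 j hj with h' | rfl
      · rw [h3 i h, h3 j h']
        exact h2 i j h h'
      · rw [h3 i h, h4]
        exact fun h'' => (hx' i h h''.symm).elim
      · rw [h3 j h', h4]
        exact fun h'' => (hx' j h' h'').elim
      · exact fun _ => rfl

/-! Ultrametric spaces with one limit point: the points `x` with `v x = 0` are equal to the limit
point, and the points with `v x = n ≠ 0` have distance `1 / 2 ^ n` from it. -/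

open Classical in
/-- The distance of the point with index `m` from the limit point. -/
noncomputable def height (m : M.El T0) : FracField (M.El T0) := if m = 0 then 0 else eps m

open Classical in
/-- The distance of the points with indices `m` and `n`. -/
noncomputable def indexDist (m n : M.El T0) : FracField (M.El T0) :=
  if m = n then 0 else max (height m) (height n)

theorem height_zero : height (0 : M.El T0) = 0 := if_pos rfl

theorem height_of_ne {m : M.El T0} (h : m ≠ 0) : height m = eps m := if_neg h

theorem height_nonneg (m : M.El T0) : 0 ≤ height m := by
  unfold height
  split_ifs
  exacts [le_rfl, (eps_pos m).le]

theorem height_le_eps (m : M.El T0) : height m ≤ eps m := by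
  unfold height
  split_ifs
  exacts [(eps_pos m).le, le_rfl]

theorem height_le_one (m : M.El T0) : height m ≤ 1 := by
  rw [← eps_zero (M := M)]
  exact (height_le_eps m).trans (eps_anti zero_le)

theorem indexDist_self (m : M.El T0) : indexDist m m = 0 := if_pos rfl

theorem indexDist_comm (m n : M.El T0) : indexDist m n = indexDist n m := by
  unfold indexDist
  rw [max_comm]
  simp only [eq_comm]

theorem height_le_indexDist {m n : M.El T0} (h : m ≠ n) : height m ≤ indexDist m n := by
  rw [indexDist, if_neg h]
  exact le_max_left _ _

theorem indexDist_nonneg (m n : M.El T0) : 0 ≤ indexDist m n := by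
  unfold indexDist
  split_ifs
  exacts [le_rfl, (height_nonneg m).trans (le_max_left _ _)]

theorem indexDist_pos {m n : M.El T0} (h : m ≠ n) : 0 < indexDist m n := by
  by_cases hm : m = 0
  · rw [indexDist_comm]
    refine lt_of_lt_of_le ?_ (height_le_indexDist h.symm)
    rw [height_of_ne fun hn => h (hm.trans hn.symm)]
    exact eps_pos n
  · refine lt_of_lt_of_le ?_ (height_le_indexDist h)
    rw [height_of_ne hm]
    exact eps_pos m

theorem indexDist_eq_zero {m n : M.El T0} : indexDist m n = 0 ↔ m = n :=
  ⟨fun h => by by_contra h'; exact (indexDist_pos h').ne' h, fun h => if_pos h⟩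

theorem height_le_add (m n : M.El T0) : height m ≤ height n + indexDist m n := by
  by_cases h : m = n
  · rw [h]
    linarith [indexDist_nonneg n n]
  · linarith [height_le_indexDist h, height_nonneg n]

/-- If `k` differs from both `m` and `n`, the two heights are bounded by one summand each, so their
maximum is at most the sum. -/
theorem indexDist_triangle (m n k : M.El T0) :
    indexDist m n ≤ indexDist m k + indexDist k n := by
  have h1 := indexDist_nonneg m k
  have h2 := indexDist_nonneg k n
  by_cases hmk : m = k
  · subst hmk
    linarith
  by_cases hkn : k = n
  · subst hkn
    linarith
  have h3 := height_le_indexDist hmk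
  have h4 := height_le_indexDist (Ne.symm hkn)
  rw [indexDist_comm n k] at h4
  conv_lhs => unfold indexDist
  split_ifs
  · linarith
  · exact max_le (by linarith) (by linarith)

theorem zero_indexDist (m : M.El T0) : indexDist 0 m = height m := by
  unfold indexDist
  rw [height_zero, max_eq_right (height_nonneg m)]
  split_ifs with h
  · rw [← h, height_zero]
  · rfl

theorem height_lt_eps {m k : M.El T0} : height m < eps k ↔ m = 0 ∨ k < m := by
  by_cases h : m = 0
  · simp [h, height_zero, eps_pos]
  · rw [height_of_ne h, or_iff_right h, ← not_le, eps_le_eps, not_le]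

open Classical in
theorem height_eq_dyadic (m : M.El T0) :
    height m = of (if m = 0 then 0 else 1) * eps m := by
  unfold height
  split_ifs <;> simp

open Classical in
-- Of two different nonzero indices the smaller has the larger height. The case distinction on the
-- exponent gives the metric as a definable dyadic real.
theorem indexDist_eq_dyadic (m n : M.El T0) : indexDist m n =
    of (if m = n then 0 else 1) *
      eps (if m = 0 then n else if n = 0 then m else if m ≤ n then m else n) := by
  unfold indexDist
  by_cases hmn : m = n
  · simp [hmn]
  rw [if_neg hmn, if_neg hmn, map_one, one_mul]
  split_ifs with h1 h2 h3
  · rw [h1, height_zero, max_eq_right (height_nonneg n),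
      height_of_ne fun h => hmn (h1.trans h.symm)]
  · rw [h2, height_zero, max_eq_left (height_nonneg m), height_of_ne h1]
  · rw [height_of_ne h1, height_of_ne h2, max_eq_left (eps_anti h3)]
  · rw [height_of_ne h1, height_of_ne h2, max_eq_right (eps_anti (not_le.1 h3).le)]

/-- The equality `e` and the distance `d` of points are given by their indices. -/
structure IsIndexSpace (v : M.El (T1 ⇒ T0)) (e : M.El (T1 ⇒ T1 ⇒ T0)) (d : M.El (T1 ⇒ T1 ⇒ T1)) :
    Prop where
  char_fun : ∀ x y, e x y = M.zero ∨ e x y = M.one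
  same_iff : ∀ x y, Same e x y ↔ v x = v y
  val_dist : ∀ x y k, (seq (d x y)).val k = indexDist (v x) (v y)

open Classical in
theorem exists_isIndexSpace (v : M.El (T1 ⇒ T0)) : ∃ e d, IsIndexSpace v e d := by
  refine ⟨lam fun x => lam fun y => if v x = v y then M.one else M.zero,
    lam fun x => lam fun y => dyadic (if v x = v y then 0 else 1)
      (if v x = 0 then v y else if v y = 0 then v x else if v x ≤ v y then v x else v y),
    fun x y => ?_, fun x y => ?_, fun x y k => ?_⟩
  · rw [lam_app, lam_app]
    split_ifs <;> simp
  · rw [Same, lam_app, lam_app]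
    split_ifs with h <;> simp [h, one_ne_zero'.symm]
  · rw [lam_app, lam_app, val_dyadic, indexDist_eq_dyadic]

namespace IsIndexSpace

variable {v : M.El (T1 ⇒ T0)} {e : M.El (T1 ⇒ T1 ⇒ T0)} {d : M.El (T1 ⇒ T1 ⇒ T1)}

theorem inBall_iff (h : IsIndexSpace v e d) {x y : M.El T1} {k : M.El T0} :
    InBall d x k y ↔ indexDist (v x) (v y) < eps k :=
  RatSeq.const_lt_const_iff (RatSeq.isProper_seq _) (RatSeq.isProper_invTwoPow _)
    (h.val_dist x y) (RatSeq.val_invTwoPow _)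

theorem inClosedBall_iff (h : IsIndexSpace v e d) {x y : M.El T1} {k : M.El T0} :
    InClosedBall d x k y ↔ indexDist (v x) (v y) ≤ eps k :=
  RatSeq.const_le_const_iff (RatSeq.isProper_seq _) (RatSeq.isProper_invTwoPow _)
    (h.val_dist x y) (RatSeq.val_invTwoPow _)

theorem inBall_zero_iff (h : IsIndexSpace v e d) {x y : M.El T1} {k : M.El T0} (hx : v x = 0) :
    InBall d x k y ↔ v y = 0 ∨ k < v y := by
  rw [h.inBall_iff, hx, zero_indexDist, height_lt_eps]

theorem isMetric (h : IsIndexSpace v e d) : IsMetric e d where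
  char_fun := h.char_fun
  equiv := by
    refine ⟨fun x => ?_, fun {x y} => ?_, fun {x y z} => ?_⟩ <;> simp only [h.same_iff]
    exacts [fun h => h.symm, fun h h' => h.trans h']
  isReal x y := (isReal_iff _).2 fun n m => by
    simp only [h.val_dist]
    constructor <;> linarith [eps_pos n]
  congr x x' y y' hx hy := by
    rw [h.same_iff] at hx hy
    have hx' := h.val_dist x' y'
    rw [← hx, ← hy] at hx'
    constructor
    · exact (RatSeq.const_le_const_iff (RatSeq.isProper_seq _) (RatSeq.isProper_seq _)
        (h.val_dist x y) hx').2 le_rfl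
    · exact (RatSeq.const_le_const_iff (RatSeq.isProper_seq _) (RatSeq.isProper_seq _)
        hx' (h.val_dist x y)).2 le_rfl
  eq_zero_iff x y := by
    rw [h.same_iff, ← indexDist_eq_zero, le_antisymm_iff, RatSeq.eq,
      RatSeq.const_le_const_iff (RatSeq.isProper_seq _) (RatSeq.isProper_ofNumber _)
        (h.val_dist x y) (RatSeq.val_ofNumber _),
      RatSeq.const_le_const_iff (RatSeq.isProper_ofNumber _) (RatSeq.isProper_seq _)
        (RatSeq.val_ofNumber _) (h.val_dist x y), zero_eq, map_zero]
  nonneg x y := by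
    rw [RatSeq.const_le_const_iff (RatSeq.isProper_ofNumber _) (RatSeq.isProper_seq _)
        (RatSeq.val_ofNumber _) (h.val_dist x y), zero_eq, map_zero]
    exact indexDist_nonneg _ _
  symm x y := by
    have h' := h.val_dist y x
    rw [indexDist_comm] at h'
    constructor
    · exact (RatSeq.const_le_const_iff (RatSeq.isProper_seq _) (RatSeq.isProper_seq _)
        (h.val_dist x y) h').2 le_rfl
    · exact (RatSeq.const_le_const_iff (RatSeq.isProper_seq _) (RatSeq.isProper_seq _)
        h' (h.val_dist x y)).2 le_rfl
  triangle x y z := by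
    refine (RatSeq.const_le_const_iff (RatSeq.isProper_seq _)
      ((RatSeq.isProper_seq _).add (RatSeq.isProper_seq _)) (h.val_dist x y) fun k => ?_).2
      (indexDist_triangle (v x) (v y) (v z))
    rw [RatSeq.val_add (RatSeq.isProper_seq _) (RatSeq.isProper_seq _), h.val_dist, h.val_dist]

/-- Either some index recurs beyond every bound, which gives a subsequence of equal points, or every
index is eventually left for good, and then the sequence itself converges to the limit point. -/
theorem sequentiallyCompact (h : IsIndexSpace v e d) {x₀ : M.El T1} (hx₀ : v x₀ = 0) :
    SequentiallyCompact d := by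
  intro s
  by_cases H : ∃ m, ∀ N, ∃ n, N ≤ n ∧ v (s n) = m
  · obtain ⟨m, hm⟩ := H
    obtain ⟨n₀, -, hn₀⟩ := hm 0
    have hp : ∀ N, N + 1 ≤ (pick fun n => N + 1 ≤ n ∧ v (s n) = m) ∧
        v (s (pick fun n => N + 1 ≤ n ∧ v (s n) = m)) = m := fun N =>
      pick_spec (A := fun n => N + 1 ≤ n ∧ v (s n) = m) inferInstance (hm (N + 1))
    -- Each next position is found by search beyond the previous one, so the recursor on numbers
    -- suffices.
    let g := M.R n₀ (lam fun N => lam fun _ => pick fun n => N + 1 ≤ n ∧ v (s n) = m)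
    have hg : ∀ i, g (i + 1) = pick fun n => g i + 1 ≤ n ∧ v (s n) = m := fun i => by
      rw [← succ_eq, rca.R_succ, lam_app, lam_app]
    have hg' : ∀ i, v (s (g i)) = m := fun i =>
      Dec.induction (A := fun i => v (s (g i)) = m) inferInstance
        (by rw [show g 0 = n₀ from rca.R_zero _ _, hn₀]) (fun n _ => by rw [hg]; exact (hp _).2) i
    refine ⟨g, fun n => ?_, s n₀, fun k => ⟨0, fun n _ => ?_⟩⟩
    · rw [le_eq, succ_eq, succ_eq, hg]
      exact (hp _).1
    · rw [h.inBall_iff, hg', hn₀, indexDist_self]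
      exact eps_pos k
  · push Not at H
    obtain ⟨g, hg⟩ := exists_identity M T0
    refine ⟨g, fun n => by rw [hg, hg]; exact le_refl (M.succ n), x₀, fun k => ?_⟩
    have := Dec.induction (A := fun k => ∃ N, ∀ n, N ≤ n → k < v (s n)) inferInstance ?_ ?_ k
    · obtain ⟨N, hN⟩ := this
      refine ⟨N, fun n hn => ?_⟩
      rw [hg, h.inBall_zero_iff hx₀]
      exact .inr (hN n hn)
    · obtain ⟨N, hN⟩ := H 0
      exact ⟨N, fun n hn => pos_iff_ne_zero.2 (hN n hn)⟩
    · rintro k ⟨N, hN⟩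
      obtain ⟨N', hN'⟩ := H (k + 1)
      exact ⟨max N N', fun n hn => lt_of_le_of_ne
        (add_one_le_iff'.2 (hN n ((le_max_left _ _).trans hn)))
        (hN' n ((le_max_right _ _).trans hn)).symm⟩

/-- If a ball of radius `2 ^ (-k)` about `x₀` contains no other point of `S`, all points of `S` have
index at most `k`; by the pigeonhole principle two of any `k + 2` such points are equal. -/
theorem limitPointCompact (h : IsIndexSpace v e d) (hI : M.SigmaInd) {x₀ : M.El T1}
    (hx₀ : v x₀ = 0) : LimitPointCompact e d := by
  intro S _ hS
  refine ⟨x₀, fun k => ?_⟩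
  by_contra! H
  refine hS ⟨k + 1, fun w hw => ?_⟩
  by_contra! Hw
  obtain ⟨i, j, hi, hj, hij, hv⟩ := hI.pigeonhole (k + 1) (lam fun i => v (w i)) fun i hi => by
    rw [lam_app, lt_add_one_iff']
    by_contra! hk
    have hne : v (w i) ≠ 0 := (zero_le.trans_lt hk).ne'
    refine H (w i) (Hw i hi) ?_ ((h.inBall_zero_iff hx₀).2 (.inr hk))
    rw [h.same_iff, hx₀]
    exact hne.symm
  rw [lam_app, lam_app] at hv
  exact hw i j hi hj hij ((h.same_iff _ _).2 hv)

/-- The open set containing `x₀` takes in all indices above some `k`. The remaining indices are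
attained on a finite list of points, and an arithmetical induction along the list bounds the sets
they need. -/
theorem countablyCompact (h : IsIndexSpace v e d) (hI : M.SigmaInd) {x₀ : M.El T1}
    (hx₀ : v x₀ = 0) : CountablyCompact e d := by
  intro O hO hcov
  obtain ⟨n₀, hn₀⟩ := hcov x₀
  obtain ⟨k, hk⟩ := (hO n₀).2 x₀ hn₀
  obtain ⟨l, w, hw⟩ := hI.exists_enumeration v (k + 1)
  obtain ⟨m, hm⟩ := Dec.induction
    (A := fun l => ∃ m, ∀ i, i < l → ∃ n, n ≤ m ∧ O n (w i) = M.one) inferInstance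
    ⟨0, fun i hi => absurd hi not_lt_zero⟩ (by
      rintro l ⟨m, hm⟩
      obtain ⟨n, hn⟩ := hcov (w l)
      refine ⟨max m n, fun i hi => ?_⟩
      rcases (lt_add_one_iff'.1 hi).lt_or_eq with hi | rfl
      · obtain ⟨n', hn', hi'⟩ := hm i hi
        exact ⟨n', hn'.trans (le_max_left _ _), hi'⟩
      · exact ⟨n, le_max_right _ _, hn⟩) l
  refine ⟨max n₀ m, fun x => ?_⟩
  by_cases hx : k < v x
  · exact ⟨n₀, (le_eq _ _).mpr (le_max_left _ _), hk x ((h.inBall_zero_iff hx₀).2 (.inr hx))⟩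
  · obtain ⟨i, hi, hxi⟩ := hw x (lt_add_one_iff'.2 (not_lt.1 hx))
    obtain ⟨n, hn, hn'⟩ := hm i hi
    exact ⟨n, (le_eq _ _).mpr (hn.trans (le_max_right _ _)),
      ((hO n).1.2 x (w i) ((h.same_iff _ _).2 hxi)).trans hn'⟩

open Classical in
theorem openCoverCompact (h : IsIndexSpace v e d) (hI : M.SigmaInd) {x₀ : M.El T1}
    (hx₀ : v x₀ = 0) : OpenCoverCompact e d := by
  intro r hr hpos
  have hlt : ∀ x y q, (∀ k, (seq (d x y)).val k = q) →
      ((seq (d x y)).lt (seq (r x)) ↔ ∃ k, q + eps k < (seq (r x)).val k) := fun x y q hq => by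
    rw [RatSeq.lt, (hr.1 x).le_const_iff (RatSeq.isProper_seq _) hq]
    push Not
    rfl
  obtain ⟨k, hk⟩ := (RatSeq.lt_iff (RatSeq.isProper_ofNumber _) (RatSeq.isProper_seq _)).1 (hpos x₀)
  rw [RatSeq.val_ofNumber, zero_eq, map_zero] at hk
  obtain ⟨l, w, hw⟩ := hI.exists_enumeration v (k + 1)
  -- The centres are the listed points of index at most `k`, followed by `x₀` in place `l`, whose
  -- ball contains all points of larger index.
  refine ⟨l, lam fun i => lam fun j => if i < l then w i j else x₀ j, fun y => ?_⟩
  have h1 : ∀ i, i < l → (lam fun j => if i < l then w i j else x₀ j) = w i := fun i hi =>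
    lam_eq fun j => (if_pos hi).symm
  have h2 : (lam fun j => if l < l then w l j else x₀ j) = x₀ :=
    lam_eq fun j => (if_neg (lt_irrefl l)).symm
  by_cases hy : k < v y
  · refine ⟨l, le_refl l, ?_⟩
    rw [lam_app, h2, hlt _ _ _ (h.val_dist x₀ y)]
    refine ⟨k, ?_⟩
    have := (height_lt_eps (k := k) (m := v y)).2 (.inr hy)
    rw [hx₀, zero_indexDist]
    linarith
  · obtain ⟨i, hi, hyi⟩ := hw y (lt_add_one_iff'.2 (not_lt.1 hy))
    refine ⟨i, hi.le, ?_⟩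
    rw [lam_app, h1 i hi, hlt _ _ _ (h.val_dist (w i) y), hyi, indexDist_self]
    obtain ⟨j, hj⟩ := (RatSeq.lt_iff (RatSeq.isProper_ofNumber _) (RatSeq.isProper_seq _)).1
      (hpos (w i))
    rw [RatSeq.val_ofNumber, zero_eq, map_zero] at hj
    exact ⟨j, by linarith [eps_pos j]⟩

theorem isCompactSpace (h : IsIndexSpace v e d) (hI : M.SigmaInd) {x₀ : M.El T1}
    (hx₀ : v x₀ = 0) (c : Compactness) : IsCompactSpace c e d := by
  cases c
  · exact h.sequentiallyCompact hx₀
  · exact h.limitPointCompact hI hx₀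
  · exact h.countablyCompact hI hx₀
  · exact h.openCoverCompact hI hx₀

end IsIndexSpace

end Spaces

end HigherOrderRM.TypeStructure

/-! ### The projection principle from suprema. -/

namespace HigherOrderRM.TypeStructure

section Reversals

set_option linter.unusedSectionVars false
set_option linter.style.haveILetI false

variable {M : TypeStructure.{u}} [hM : Fact M.ModelsACA]

open FracField (of of_le of_lt of_inj of_ne_zero of_nonneg of_pos)

open Classical in
/-- The real number `1` if `P` holds, and `0` otherwise. -/
noncomputable def truthReal (M : TypeStructure.{u}) [Fact M.ModelsACA] (P : Prop) : M.El T1 :=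
  dyadic (if P then 1 else 0) 0

open Classical in
theorem val_truthReal (P : Prop) (k : M.El T0) :
    (seq (truthReal M P)).val k = if P then 1 else 0 := by
  rw [truthReal, val_dyadic, eps_zero]
  split_ifs <;> simp

theorem isReal_truthReal (P : Prop) : IsReal (truthReal M P) := isReal_dyadic _ _

namespace IsIndexSpace

variable {v : M.El (T1 ⇒ T0)} {e : M.El (T1 ⇒ T1 ⇒ T0)} {d : M.El (T1 ⇒ T1 ⇒ T1)}

/-- The characteristic functions of the points of the space other than the limit point are
continuous. -/
theorem exists_characteristic (h : IsIndexSpace v e d) : ∃ f : M.El (T0 ⇒ T1 ⇒ T1),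
    (∀ n z, f n z = truthReal M (v z = n + 1)) ∧
      ∀ n, IsUnitFunction e (f n) ∧ IsContinuous d (f n) := by
  classical
  have hf : ∀ n z, (lam fun n => lam fun z => dyadic (if v z = n + 1 then 1 else 0) 0 :
      M.El (T0 ⇒ T1 ⇒ T1)) n z = truthReal M (v z = n + 1) := fun n z => by
    rw [lam_app, lam_app, truthReal]
    congr
  refine ⟨_, hf, fun n => ⟨⟨⟨fun x => ?_, fun x y hxy => ?_⟩, fun x => ?_⟩, fun x k => ?_⟩⟩
  · rw [hf]
    exact isReal_truthReal _
  · rw [h.same_iff] at hxy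
    rw [hf, hf, hxy]
    exact ⟨RatSeq.le_refl (RatSeq.isProper_seq _), RatSeq.le_refl (RatSeq.isProper_seq _)⟩
  · rw [hf, RatSeq.const_le_const_iff (RatSeq.isProper_ofNumber _) (RatSeq.isProper_seq _)
      (RatSeq.val_ofNumber _) (val_truthReal _), RatSeq.const_le_const_iff (RatSeq.isProper_seq _)
      (RatSeq.isProper_ofNumber _) (val_truthReal _) (RatSeq.val_ofNumber _), zero_eq, one_eq,
      map_zero, map_one]
    split_ifs
    exacts [⟨zero_le_one, le_rfl⟩, ⟨le_rfl, zero_le_one⟩]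
  -- One radius serves both cases: for `v x ≠ 0` the ball contains only points equal to `x`, and
  -- around the limit point the radius `2 ^ (-(n + 1))` excludes index `n + 1`.
  · refine ⟨v x + (n + 1), fun y hy => ?_⟩
    have hiff : v y = n + 1 ↔ v x = n + 1 := by
      by_cases hxy : v x = v y
      · rw [hxy]
      · rw [h.inBall_iff] at hy
        have hx : v x = 0 := by
          by_contra hx
          have := height_le_indexDist hxy
          rw [height_of_ne hx] at this
          linarith [eps_add_le_left (v x) (n + 1)]
        rw [hx, zero_indexDist, height_lt_eps, zero_add] at hy
        rw [hx]
        rcases hy with hy | hy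
        · rw [hy]
        · exact iff_of_false hy.ne' (add_one_ne_zero n).symm
    have key : (seq (truthReal M (v x = n + 1))).lt
        ((seq (truthReal M (v x = n + 1))).add (RatSeq.invTwoPow k)) := by
      rw [RatSeq.lt_iff (RatSeq.isProper_seq _)
        ((RatSeq.isProper_seq _).add (RatSeq.isProper_invTwoPow _))]
      refine ⟨k + 1 + 1, ?_⟩
      rw [RatSeq.val_add (RatSeq.isProper_seq _) (RatSeq.isProper_invTwoPow _), val_truthReal,
        val_truthReal, RatSeq.val_invTwoPow, eps_add_one, eps_add_one]
      linarith [eps_pos k]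
    rw [hf, hf, hiff]
    exact ⟨key, key⟩

/-- The distance from the limit point is Lipschitz continuous. -/
theorem exists_height (h : IsIndexSpace v e d) : ∃ f : M.El (T1 ⇒ T1),
    (∀ z k, (seq (f z)).val k = height (v z)) ∧ IsUnitFunction e f ∧ IsLipschitz d f := by
  classical
  have hf : ∀ z k, (seq ((lam fun z => dyadic (if v z = 0 then 0 else 1) (v z) :
      M.El (T1 ⇒ T1)) z)).val k = height (v z) := fun z k => by
    rw [lam_app, val_dyadic, height_eq_dyadic]
  refine ⟨_, hf, ⟨⟨fun x => ?_, fun x y hxy => ?_⟩, fun x => ?_⟩, 1, fun x y => ?_⟩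
  · rw [lam_app]
    exact isReal_dyadic _ _
  · rw [h.same_iff] at hxy
    rw [lam_app, lam_app, hxy]
    exact ⟨RatSeq.le_refl (RatSeq.isProper_seq _), RatSeq.le_refl (RatSeq.isProper_seq _)⟩
  · rw [RatSeq.const_le_const_iff (RatSeq.isProper_ofNumber _) (RatSeq.isProper_seq _)
      (RatSeq.val_ofNumber _) (hf x), RatSeq.const_le_const_iff (RatSeq.isProper_seq _)
      (RatSeq.isProper_ofNumber _) (hf x) (RatSeq.val_ofNumber _), zero_eq, one_eq,
      map_zero, map_one]
    exact ⟨height_nonneg _, height_le_one _⟩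
  · have hv : ∀ z k, ((seq ((lam fun z => dyadic (if v z = 0 then 0 else 1) (v z) :
        M.El (T1 ⇒ T1)) z)).add ((seq (d x y)).smul 1)).val k =
        height (v z) + indexDist (v x) (v y) := fun z k => by
      rw [RatSeq.val_add (RatSeq.isProper_seq _) ((RatSeq.isProper_seq _).smul 1), hf,
        RatSeq.val_smul, h.val_dist, map_one, one_mul]
    rw [RatSeq.const_le_const_iff (RatSeq.isProper_seq _)
        ((RatSeq.isProper_seq _).add ((RatSeq.isProper_seq _).smul 1)) (hf x) (hv y),
      RatSeq.const_le_const_iff (RatSeq.isProper_seq _)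
        ((RatSeq.isProper_seq _).add ((RatSeq.isProper_seq _).smul 1)) (hf y) (hv x)]
    refine ⟨height_le_add _ _, ?_⟩
    rw [indexDist_comm]
    exact height_le_add _ _

end IsIndexSpace

/-- The supremum of the `n`-th characteristic function is `1` or `0` according to whether index `n +
1` is attained, and positivity of a real is decidable. -/
theorem SequentialSupremumPrinciple.dec_exists {c : Compactness}
    (hS : M.SequentialSupremumPrinciple c) (hI : M.SigmaInd) {v : M.El (T1 ⇒ T0)} {x₀ : M.El T1}
    (hx₀ : v x₀ = 0) : Dec fun n => ∃ x, v x = n + 1 := by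
  obtain ⟨e, d, h⟩ := exists_isIndexSpace v
  obtain ⟨f, hf, hf'⟩ := h.exists_characteristic
  obtain ⟨y, hy⟩ := hS e d h.isMetric (h.isCompactSpace hI hx₀ c) f hf'
  have hd : Dec fun n => (RatSeq.ofNumber M.zero).lt (seq (y n)) := inferInstance
  refine hd.congr fun n => ?_
  obtain ⟨h1, h2, h3⟩ := hy n
  constructor
  · intro hlt
    by_contra! hn
    refine hlt (RatSeq.le_iff (RatSeq.isProper_seq _) (RatSeq.isProper_ofNumber _) |>.2 ?_)
    have := h3 (dyadic 0 0) (isReal_dyadic _ _) fun z _ => by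
      rw [hf, RatSeq.const_le_const_iff (RatSeq.isProper_seq _) (RatSeq.isProper_seq _)
        (val_truthReal _) (val_dyadic 0 0), if_neg (hn z)]
      simp
    rw [RatSeq.le_iff (RatSeq.isProper_seq _) (RatSeq.isProper_seq _)] at this
    intro k
    have hk := this k
    rw [val_dyadic, map_zero, zero_mul] at hk
    rwa [RatSeq.val_ofNumber, zero_eq, map_zero]
  · rintro ⟨z, hz⟩ hle
    rw [h1.le_const_iff (RatSeq.isProper_ofNumber _) (RatSeq.val_ofNumber _)] at hle
    have h4 := h2 z trivial
    rw [hf, h1.const_le_iff (RatSeq.isProper_seq _) (val_truthReal _), if_pos hz] at h4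
    -- Precision `1 / 4` separates `0` from `1`.
    have h5 := hle (0 + 1 + 1)
    have h6 := h4 (0 + 1 + 1)
    rw [eps_add_one, eps_add_one, eps_zero] at h5 h6
    rw [zero_eq, map_zero] at h5
    linarith

/-- The closed ball of radius `2 ^ (-(n + 1))` removes the smaller nonzero indices, so the supremum
of the height there is `2 ^ (-(n + 1))` if index `n + 1` is attained and at most `2 ^ (-(n + 2))`
otherwise; comparison with the latter number decides. -/
theorem LipschitzSupremumPrinciple.dec_exists {c : Compactness}
    (hS : M.LipschitzSupremumPrinciple c) (hI : M.SigmaInd) {v : M.El (T1 ⇒ T0)} {x₀ : M.El T1}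
    (hx₀ : v x₀ = 0) : Dec fun n => ∃ x, v x = n + 1 := by
  obtain ⟨e, d, h⟩ := exists_isIndexSpace v
  obtain ⟨f, hf, hf', hl⟩ := h.exists_height
  obtain ⟨y, hy⟩ := hS e d h.isMetric (h.isCompactSpace hI hx₀ c) f hf' hl x₀
  have hd : Dec fun n => (RatSeq.invTwoPow (n + 1 + 1)).lt (seq (y (n + 1))) := inferInstance
  refine hd.congr fun n => ?_
  obtain ⟨h1, h2, h3⟩ := hy (n + 1)
  have hball : ∀ z, InClosedBall d x₀ (n + 1) z ↔ height (v z) ≤ eps (n + 1) := fun z => by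
    rw [h.inClosedBall_iff, hx₀, zero_indexDist]
  constructor
  · intro hlt
    by_contra! hn
    refine hlt ?_
    have := h3 (dyadic 1 (n + 1 + 1)) (isReal_dyadic _ _) fun z hz => by
      rw [RatSeq.const_le_const_iff (RatSeq.isProper_seq _) (RatSeq.isProper_seq _)
        (hf z) (val_dyadic _ _), map_one, one_mul]
      rw [hball] at hz
      by_cases hz0 : v z = 0
      · rw [hz0, height_zero]
        exact (eps_pos _).le
      · rw [height_of_ne hz0, eps_le_eps] at hz ⊢
        exact add_one_le_iff'.2 (lt_of_le_of_ne hz (hn z).symm)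
    rw [h1.le_const_iff (RatSeq.isProper_seq _) (val_dyadic _ _)] at this
    rw [h1.le_const_iff (RatSeq.isProper_invTwoPow _) (RatSeq.val_invTwoPow _)]
    simpa using this
  · rintro ⟨z, hz⟩ hle
    rw [h1.le_const_iff (RatSeq.isProper_invTwoPow _) (RatSeq.val_invTwoPow _)] at hle
    have hz' : height (v z) = eps (n + 1) := by rw [hz, height_of_ne (add_one_ne_zero n)]
    have h4 := h2 z ((hball z).2 hz'.le)
    rw [h1.const_le_iff (RatSeq.isProper_seq _) (hf z), hz'] at h4
    -- The gap is `eps (n + 1) / 2`, so two errors of `eps (n + 1) / 8` are affordable.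
    have h5 := hle (n + 1 + 1 + 1 + 1)
    have h6 := h4 (n + 1 + 1 + 1 + 1)
    have h7 : eps (n + 1 + 1 + 1 + 1) = eps (n + 1) / 2 / 2 / 2 := by simp only [eps_add_one]
    rw [h7] at h5 h6
    rw [eps_add_one (n + 1)] at h5
    linarith [eps_pos (n + 1)]

/-- The projection principle follows from its instances for index functions. -/
theorem boot_of_dec_exists (h : ∀ (v : M.El (T1 ⇒ T0)) (x₀ : M.El T1), v x₀ = 0 →
    Dec fun n => ∃ x, v x = n + 1) : M.Boot := by
  classical
  intro Y
  suffices hd : Dec fun n => ∃ f, Y f n = M.zero by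
    have hi : Internal fun n => if ∃ f, Y f n = M.zero then M.one else M.zero :=
      Internal.ite (fun n => ∃ f, Y f n = M.zero) (fun _ => M.one) fun _ => M.zero
    refine ⟨lam fun n => if ∃ f, Y f n = M.zero then M.one else M.zero, fun n => ?_, fun n => ?_⟩
    · rw [lam_app]
      split_ifs <;> simp
    · rw [lam_app]
      split_ifs with hn <;> simp [hn, one_ne_zero'.symm]
  -- The space needs a limit point, that is, a pair with `Y f n ≠ 0`. If there is none, the
  -- projection contains every number.
  by_cases hY : ∀ f n, Y f n = M.zero
  · exact (Dec.const True).congr fun n => by simp [hY, El.nonempty M T1]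
  push Not at hY
  obtain ⟨f₀, n₀, h₀⟩ := hY
  -- A point codes the number `x 0` and, by its tail, a candidate witness. The shift to `x 0 + 1`
  -- reserves index `0` for the failures, which together form the limit point.
  let v : M.El (T1 ⇒ T0) :=
    lam fun x => if Y (lam fun k => x (M.succ k)) (x M.zero) = M.zero then x M.zero + 1 else 0
  have hv : ∀ x, v x =
      if Y (lam fun k => x (M.succ k)) (x M.zero) = M.zero then x M.zero + 1 else 0 :=
    fun x => lam_app _ _
  have hcons : ∀ n f, v (cons n f) = if Y f n = M.zero then n + 1 else 0 := fun n f => by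
    have : (lam fun k => cons n f (M.succ k)) = f := lam_eq fun k => (cons_succ n f k).symm
    rw [hv, this, cons_zero]
  refine (h v (cons n₀ f₀) (by rw [hcons, if_neg h₀])).congr fun n => ⟨?_, ?_⟩
  · rintro ⟨x, hx⟩
    rw [hv] at hx
    split_ifs at hx with hx'
    · exact ⟨_, add_one_inj hx ▸ hx'⟩
    · exact (add_one_ne_zero n hx.symm).elim
  · rintro ⟨f, hf⟩
    exact ⟨cons n f, by rw [hcons, if_pos hf]⟩

end Reversals

end HigherOrderRM.TypeStructure

/-- In every model of `ACA₀^ω` plus `Σ`-induction, hence over this theory, the supremum principle, its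
restriction to Lipschitz continuous functions, the sequential supremum principle and the projection
principle are equivalent, for each of the four notions of compactness. -/
theorem theorem2p9 (M : HigherOrderRM.TypeStructure.{u}) (hACA : M.ModelsACA) (hInd : M.SigmaInd)
    (c : HigherOrderRM.TypeStructure.Compactness) :
    List.TFAE [M.SupremumPrinciple c, M.LipschitzSupremumPrinciple c,
      M.SequentialSupremumPrinciple c, M.Boot] := by
  have : Fact M.ModelsACA := ⟨hACA⟩
  tfae_have 1 → 2 := fun h => h.lipschitz
  tfae_have 2 → 4 := fun h =>
    HigherOrderRM.TypeStructure.boot_of_dec_exists fun _ _ hx => h.dec_exists hInd hx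
  tfae_have 3 → 4 := fun h =>
    HigherOrderRM.TypeStructure.boot_of_dec_exists fun _ _ hx => h.dec_exists hInd hx
  tfae_have 4 → 1 := fun h => h.supremumPrinciple c
  tfae_have 4 → 3 := fun h => h.sequentialSupremumPrinciple c
  tfae_finish
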